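/- **Model.** Let $q>0$, $s\ge 4q$, $K\ge 0$, $\eta^0>0$ and $\kappa>K/\eta^0$. Truth is a standard Brownian path; initially only the answer to question $0$ is known, so the conjecture about question $d\ge 0$ has variance $\sigma^2(d)=d$. If the conjecture about each question $x$ has variance $\sigma^2_x$, the value of knowledge is $\int_{\mathbb R}\max\{(q-\sigma_x^2)/q,0\}\,dx$; $V(d;\infty)$ denotes the increase in this value when the answer to question $d$ is discovered in addition. A funding scheme is a pair of an ex-post reward $\zeta\ge0$ and an ex-ante cost reduction $h\ge0$ with $\zeta+\kappa h=K$. Given $(\zeta,h)$, the researcher chooses novelty $d\ge0$ and output (probability of discovery) $\rho\in[0,1)$ to maximize $$\rho\bigl(V(d;\infty)+f(d)\,\zeta\bigr)-(\eta^0-h)\,\bigl(\mathrm{erf}^{-1}(\rho)\bigr)^2 d,\qquad f(d)=\min\{d/s,1\}.$$ A pair $(d,\rho)$ is implementable if it solves the researcher's problem for some funding scheme; the research possibility frontier $d(\rho;K)$ is the largest $d$ implementable together with $\rho$. Optimal funding consists of a funding scheme and a solution $(d,\rho)$ of the researcher's problem under it (ties resolved in favour of the funder) that maximizes $\rho V(d;\infty)$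 over all implementable pairs. Output is said to decrease in novelty throughout if $d(\rho;K)$ is strictly decreasing in $\rho$, or if any two implementable pairs with $d_1<d_2$ satisfy $\rho_1>\rho_2$. **Proposition.** The optimal funding scheme can be a combination of the two instruments or can focus on only one of them: there are parameters for which optimal funding exists and every optimal scheme has $\zeta>0,h>0$; parameters for which it exists and every optimal scheme has $\zeta=0,h>0$; and parameters for which it exists and every optimal scheme has $\zeta>0,h=0$. Moreover: 1. For all parameters, if output decreases in novelty throughout, then optimal funding never induces excessive novelty: every optimal funding has $d\le 3q$. 2. Otherwise optimal funding may induce excessive novelty: there are parameters for which output does not decrease in novelty throughout, optimal funding exists, and every optimal funding has $d>3q$. If output increases in novelty among funding schemes that induce $d<s$ (any implementable pairs with $d_1<d_2<s$ satisfy $\rho_1<\rho_2$), moderately excessive novelty can be optimal: for $q=1$, $s=6$, $K=3$, $\kappa=16$, $\eta^0=1$ output does not decrease in novelty throughout, it increases in novelty among the schemes that induce $d<s$, optimal funding exists, and every optimal funding has $\zeta>0$, $h>0$ and $d\in(3q,s)$. -/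

import Mathlib

namespace ResearchFunding

noncomputable section

/-- The Gaussian error function. -/
def erf (t : ℝ) : ℝ := 2 / Real.sqrt Real.pi * ∫ x in (0 : ℝ)..t, Real.exp (-x ^ 2)

/-- The inverse error function; `erf` is injective with range `(-1, 1)`, and the values of
`erfInv` outside `(-1, 1)` are never used. -/
def erfInv : ℝ → ℝ := Function.invFun erf

/-- The cost factor of a probability of discovery `ρ ∈ [0, 1)`. -/
def costFactor (ρ : ℝ) : ℝ := (erfInv ρ) ^ 2

/-- Variance of the conjecture (of a standard Brownian path) about question `x` when only the
answer to question `0` is known. -/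
def priorVariance (x : ℝ) : ℝ := |x|

/-- Variance of the conjecture about question `x` when exactly the answers to the questions `0`
and `d` are known, where `0 ≤ d`: a Brownian bridge in between, a free Brownian motion outside. -/
def posteriorVariance (d x : ℝ) : ℝ :=
  if x ≤ 0 then -x else if x < d then x * (d - x) / d else x - d

/-- The value of knowledge under which the conjecture about question `x` has variance `v x`.
On each question the decision maker with error tolerance `q` obtains `1 - v x / q` in expectation
from the best proactive action (the conditional mean), and `0` from the outside option. -/
def valueOfKnowledge (q : ℝ) (v : ℝ → ℝ) : ℝ := ∫ x, max ((q - v x) / q) 0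

/-- `V(d;∞)`: the benefit of a discovery at distance `d` beyond the frontier of knowledge. -/
def benefit (q d : ℝ) : ℝ :=
  valueOfKnowledge q (posteriorVariance d) - valueOfKnowledge q priorVariance

/-- The parameters of the funding problem: error tolerance `q`, reward cap `s`, budget `K`,
relative price of cost reductions `κ`, initial cost parameter `η₀`. -/
structure Env where
  q : ℝ
  s : ℝ
  K : ℝ
  κ : ℝ
  η₀ : ℝ
  q_pos : 0 < q
  s_ge : 4 * q ≤ s
  K_nonneg : 0 ≤ K
  η₀_pos : 0 < η₀
  κ_gt : K / η₀ < κ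

/-- The probability of receiving the reward when the conjecture has variance `v`. -/
def rewardProb (s v : ℝ) : ℝ := if v < s then v / s else 1

/-- `(ζ, h)`, a reward and a cost reduction, is a funding scheme on the budget line. -/
def IsScheme (E : Env) (ζ h : ℝ) : Prop := 0 ≤ ζ ∧ 0 ≤ h ∧ ζ + E.κ * h = E.K

/-- The payoff of a researcher who expands knowledge by `d` with success probability `ρ`. -/
def researcherPayoff (E : Env) (ζ h d ρ : ℝ) : ℝ :=
  ρ * (benefit E.q d + rewardProb E.s (priorVariance d) * ζ)
    - (E.η₀ - h) * (costFactor ρ * priorVariance d)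

/-- `(d, ρ)` solves the researcher's problem under the scheme `(ζ, h)`. (Certain discovery,
`ρ = 1`, has infinite cost and is not available.) -/
def IsResearcherChoice (E : Env) (ζ h d ρ : ℝ) : Prop :=
  0 ≤ d ∧ ρ ∈ Set.Ico (0 : ℝ) 1 ∧
    ∀ d' ρ' : ℝ, 0 ≤ d' → ρ' ∈ Set.Ico (0 : ℝ) 1 →
      researcherPayoff E ζ h d' ρ' ≤ researcherPayoff E ζ h d ρ

/-- The novelty-output pairs `(d, ρ)` that some funding scheme implements. -/
def Implementable (E : Env) (d ρ : ℝ) : Prop :=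
  ∃ ζ h : ℝ, IsScheme E ζ h ∧ IsResearcherChoice E ζ h d ρ

/-- `d = d(ρ;K)`: the pair `(d, ρ)` lies on the research possibility frontier, that is, `d` is the
largest distance that is implementable together with output `ρ`. -/
def OnFrontier (E : Env) (d ρ : ℝ) : Prop :=
  Implementable E d ρ ∧ ∀ d' : ℝ, Implementable E d' ρ → d' ≤ d

/-- Output decreases in novelty throughout: either the frontier `ρ ↦ d(ρ;K)` is strictly
decreasing, or larger implementable novelty always comes with strictly smaller output.
(The second alternative allows many outputs at one novelty, as happens at `d = s`.) -/
def OutputDecreases (E : Env) : Prop :=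
  (∀ d₁ ρ₁ d₂ ρ₂ : ℝ, OnFrontier E d₁ ρ₁ → OnFrontier E d₂ ρ₂ → ρ₁ < ρ₂ → d₂ < d₁) ∨
  (∀ d₁ ρ₁ d₂ ρ₂ : ℝ, Implementable E d₁ ρ₁ → Implementable E d₂ ρ₂ → d₁ < d₂ → ρ₂ < ρ₁)

/-- Output increases in novelty for the funding schemes that induce `d < s`. -/
def OutputIncreasesBelowCap (E : Env) : Prop :=
  ∀ d₁ ρ₁ d₂ ρ₂ : ℝ, Implementable E d₁ ρ₁ → Implementable E d₂ ρ₂ →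
    d₁ < d₂ → d₂ < E.s → ρ₁ < ρ₂

/-- The scheme `(ζ, h)` together with the researcher's choice `(d, ρ)` maximizes the myopic
expected benefit `ρ V(d;∞)`. (As usual, a researcher who is indifferent chooses what the funder
prefers.) -/
def IsOptimalFunding (E : Env) (ζ h d ρ : ℝ) : Prop :=
  IsScheme E ζ h ∧ IsResearcherChoice E ζ h d ρ ∧
    ∀ d' ρ' : ℝ, Implementable E d' ρ' → ρ' * benefit E.q d' ≤ ρ * benefit E.q d

/-- Optimal funding exists, and every optimal scheme `(ζ, h)` with its induced novelty `d` has
the property `P ζ h d`. -/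
def OptimalFundingHas (E : Env) (P : ℝ → ℝ → ℝ → Prop) : Prop :=
  (∃ ζ h d ρ : ℝ, IsOptimalFunding E ζ h d ρ) ∧
    ∀ ζ h d ρ : ℝ, IsOptimalFunding E ζ h d ρ → P ζ h d

end

end ResearchFunding

namespace ResearchFunding

open Real

/-! Writing output as `erf t` with `t ≥ 0` removes the inverse error function: the researcher
maximizes `erf t * W d - η t² d`, where `W` is `successReward` and `η` is `cost`. Below `4q`, `W d =
d (A - d/(6q))` with `A = reach ζ`. The two first-order conditions then separate. With `m =
marginalCost` and `g = costElasticity` they give `m (2 - g) = A/η`, which pins down `t`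
(`IsChoice.inducedRatio_eq`), and `d = 6 q A (1 - g)/(2 - g)` (`IsChoice.dist_eq`). Since `m`
increases and `g` decreases with values in `(0, 1/2)`, output and the novelty share both rise with
`A/η`. Along the budget line `A/η` is monotone in the reward, with the sign of `cost 0 / s - 1/κ`.
Beyond `4q` the benefit is strictly convex up to the cap, so any other choice is exactly `s`
(`IsChoice.lt_or_eq_cap`).

If output decreases in novelty, the cap is not optimal: its benefit is at most `4q/3`, less than
that of the choice without rewards, so it would need more output as well as more novelty. For an
interior `d > 3q` the reward is lowered slightly. The delicate point is that the researcher then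
does not jump to the cap. `IsChoice.rewardGain_lt_cap` shows that at any indifference between the
two, a lower reward favours the interior choice; compactness turns this into a continuous path of
interior choices. The sign of `cost 0 / s - 1/κ` leaves three cases. Either the path yields more
benefit with no less output, contradicting optimality, or it moves novelty and output in the same
direction, contradicting the hypothesis. A strictly decreasing frontier is handled by comparing
several points of the path.

The existence claims come from three explicit environments. Optimal funding always exists because
the choices form a compact set. When the budget is small all choices are interior. Expensive cost
reductions then make rewards raise output and useful novelty together, while a remote reward cap
makes cost reductions better. In the mixed environment rewards raise both quantities until the full
reward triggers a jump to the cap. Rational enclosures of `erf` and `exp` show that reward `2.7`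
beats every choice at the cap or at novelty at most `3q`. -/

/-! ### The error function -/

lemma hasDerivAt_erf (t : ℝ) : HasDerivAt erf (2 / √π * exp (-t ^ 2)) t := by
  have hc : Continuous fun x : ℝ => exp (-x ^ 2) := by fun_prop
  exact (hc.integral_hasStrictDerivAt 0 t).hasDerivAt.const_mul _

lemma continuous_erf : Continuous erf :=
  continuous_iff_continuousAt.2 fun t => (hasDerivAt_erf t).continuousAt

lemma two_div_sqrt_pi_pos : 0 < 2 / √π := by positivity

lemma strictMono_erf : StrictMono erf :=
  strictMono_of_hasDerivAt_pos hasDerivAt_erf fun _ => by positivity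

lemma erf_zero : erf 0 = 0 := by simp [erf]

lemma erf_pos {t : ℝ} (ht : 0 < t) : 0 < erf t := erf_zero ▸ strictMono_erf ht

lemma erf_nonneg {t : ℝ} (ht : 0 ≤ t) : 0 ≤ erf t := erf_zero ▸ strictMono_erf.monotone ht

lemma tendsto_erf_atTop : Filter.Tendsto erf Filter.atTop (nhds 1) := by
  have hI : MeasureTheory.IntegrableOn (fun x : ℝ => exp (-x ^ 2)) (Set.Ioi 0) := by
    have := (integrable_exp_neg_mul_sq (b := 1) one_pos).integrableOn (s := Set.Ioi (0 : ℝ))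
    simpa using this
  have h := MeasureTheory.intervalIntegral_tendsto_integral_Ioi 0 hI Filter.tendsto_id
  have hv : ∫ x in Set.Ioi (0 : ℝ), exp (-x ^ 2) = √π / 2 := by
    simpa using integral_gaussian_Ioi 1
  rw [hv] at h
  have h2 := h.const_mul (2 / √π)
  have : 2 / √π * (√π / 2) = 1 := by
    have : √π ≠ 0 := by positivity
    field_simp
  rw [this] at h2
  exact h2

lemma erf_lt_one (t : ℝ) : erf t < 1 :=
  (strictMono_erf (lt_add_one t)).trans_le
    (strictMono_erf.monotone.ge_of_tendsto tendsto_erf_atTop _)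

lemma erfInv_erf (t : ℝ) : erfInv (erf t) = t :=
  Function.leftInverse_invFun strictMono_erf.injective t

lemma exists_erf_eq {ρ : ℝ} (hρ : ρ ∈ Set.Ico (0 : ℝ) 1) : ∃ t, 0 ≤ t ∧ erf t = ρ := by
  obtain ⟨T, hT, hT0⟩ := ((tendsto_erf_atTop.eventually (lt_mem_nhds hρ.2)).and
    (Filter.eventually_ge_atTop 0)).exists
  obtain ⟨t, ht, h⟩ := intermediate_value_Icc hT0 continuous_erf.continuousOn
    (show ρ ∈ Set.Icc (erf 0) (erf T) from ⟨by rw [erf_zero]; exact hρ.1, hT.le⟩)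
  exact ⟨t, ht.1, h⟩

/-- A function vanishing at `0` with positive derivative on `(0, ∞)` is positive there. -/
lemma pos_of_hasDerivAt_pos {f f' : ℝ → ℝ} (hf : ∀ t, HasDerivAt f (f' t) t)
    (h : ∀ t, 0 < t → 0 < f' t) (h0 : f 0 = 0) {t : ℝ} (ht : 0 < t) : 0 < f t := by
  have := strictMonoOn_of_deriv_pos (convex_Ici (0 : ℝ))
    (fun x _ => (hf x).continuousAt.continuousWithinAt)
    (fun x hx => by
      rw [interior_Ici] at hx
      rw [(hf x).deriv]; exact h x hx)
  rw [← h0]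
  exact this Set.self_mem_Ici ht.le ht

lemma hasDerivAt_exp_neg_sq (t : ℝ) :
    HasDerivAt (fun t : ℝ => exp (-t ^ 2)) (-(2 * t) * exp (-t ^ 2)) t := by
  have := ((hasDerivAt_pow 2 t).fun_neg).exp
  exact this.congr_deriv (by simp; ring)

/-- Lower bound `erf t > 2 t exp (-t²) / √π`. -/
lemma mul_exp_lt_erf {t : ℝ} (ht : 0 < t) : 2 / √π * (t * exp (-t ^ 2)) < erf t := by
  have := pos_of_hasDerivAt_pos
    (f := fun t => erf t - 2 / √π * (t * exp (-t ^ 2)))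
    (f' := fun t => 2 / √π * exp (-t ^ 2) * (2 * t ^ 2))
    (fun t => by
      exact ((hasDerivAt_erf t).sub (((hasDerivAt_id t).mul
        (hasDerivAt_exp_neg_sq t)).const_mul (2 / √π))).congr_deriv (by simp only [id]; ring))
    (fun t ht => by positivity) (by simp [erf_zero]) ht
  linarith

/-- Upper bound `erf t ≤ 2 t / √π`. -/
lemma erf_le_linear {t : ℝ} (ht : 0 < t) : erf t ≤ 2 / √π * t := by
  have := pos_of_hasDerivAt_pos
    (f := fun t => 2 / √π * t - erf t)
    (f' := fun t => 2 / √π * (1 - exp (-t ^ 2)))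
    (fun t => by
      exact (((hasDerivAt_id t).const_mul (2 / √π)).sub (hasDerivAt_erf t)).congr_deriv (by ring))
    (fun t ht => by
      have : exp (-t ^ 2) < 1 := by rw [exp_lt_one_iff]; nlinarith
      have := sub_pos.2 this
      positivity) (by simp [erf_zero]) ht
  linarith

/-! ### Marginal cost, elasticity and the functions that determine interior choices -/

/-- The marginal cost of output `erf t`, per unit of novelty. -/
noncomputable def marginalCost (t : ℝ) : ℝ := √π * t * exp (t ^ 2)

/-- The inverse elasticity of the cost of output `erf t`. -/
noncomputable def costElasticity (t : ℝ) : ℝ := t * exp (-t ^ 2) / (√π * erf t)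

/-- The ratio of the effective productivity to the cost parameter that induces output `erf t`. -/
noncomputable def inducedRatio (t : ℝ) : ℝ := marginalCost t * (2 - costElasticity t)

/-- Novelty at output `erf t`, up to the scale of the reward. -/
noncomputable def noveltyShare (t : ℝ) : ℝ := (1 - costElasticity t) / (2 - costElasticity t)

lemma costElasticity_pos {t : ℝ} (ht : 0 < t) : 0 < costElasticity t := by
  have := erf_pos ht
  unfold costElasticity; positivity

lemma costElasticity_lt_half {t : ℝ} (ht : 0 < t) : costElasticity t < 1 / 2 := by
  have h := mul_exp_lt_erf ht
  have := erf_pos ht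
  have hp : 0 < √π := by positivity
  unfold costElasticity
  rw [div_lt_iff₀ (by positivity)]
  rw [div_mul_eq_mul_div, div_lt_iff₀ hp] at h
  linarith

lemma exp_half_le_costElasticity {t : ℝ} (ht : 0 < t) :
    exp (-t ^ 2) / 2 ≤ costElasticity t := by
  have h := erf_le_linear ht
  have := erf_pos ht
  have hp : 0 < √π := by positivity
  unfold costElasticity
  rw [le_div_iff₀ (by positivity)]
  rw [div_mul_eq_mul_div, le_div_iff₀ hp] at h
  nlinarith [exp_pos (-t ^ 2)]

/-- `t ↦ t / erf t` is strictly increasing. -/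
lemma div_erf_lt {a b : ℝ} (ha : 0 < a) (hab : a < b) : a / erf a < b / erf b := by
  have hb := ha.trans hab
  have key : StrictMonoOn (fun t => t / erf t) (Set.Ioi 0) := by
    refine strictMonoOn_of_deriv_pos (convex_Ioi 0) (fun t ht => ?_) (fun t ht => ?_)
    · exact (continuousAt_id.div (hasDerivAt_erf t).continuousAt
        (erf_pos ht).ne').continuousWithinAt
    · rw [interior_Ioi] at ht
      have h := (hasDerivAt_id t).div (hasDerivAt_erf t) (erf_pos ht).ne'
      have h' : deriv (fun t => t / erf t) t = _ := h.deriv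
      rw [h']
      have := erf_pos ht
      have h1 := mul_exp_lt_erf ht
      apply div_pos _ (by positivity)
      simp only [id]
      nlinarith
  exact key ha hb hab

/-- `costElasticity` is strictly decreasing. -/
lemma costElasticity_lt {a b : ℝ} (ha : 0 < a) (hab : a < b) :
    costElasticity b < costElasticity a := by
  have hb := ha.trans hab
  have key : StrictAntiOn (fun t => t * exp (-t ^ 2) / erf t) (Set.Ioi 0) := by
    refine strictAntiOn_of_deriv_neg (convex_Ioi 0) (fun t ht => ?_) (fun t ht => ?_)
    · exact ((by fun_prop : ContinuousAt (fun t : ℝ => t * exp (-t ^ 2)) t).div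
        (hasDerivAt_erf t).continuousAt (erf_pos ht).ne').continuousWithinAt
    · rw [interior_Ioi] at ht
      have h := ((hasDerivAt_id t).mul (hasDerivAt_exp_neg_sq t)).div (hasDerivAt_erf t)
        (erf_pos ht).ne'
      have h' : deriv (fun t => t * exp (-t ^ 2) / erf t) t = _ := h.deriv
      rw [h']
      have := erf_pos ht
      -- The derivative of the quotient has the opposite sign to this function, whose own derivative
      -- collapses to `4 t erf t`.
      have hN := pos_of_hasDerivAt_pos
        (f := fun t => 2 / √π * (t * exp (-t ^ 2)) + (2 * t ^ 2 - 1) * erf t)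
        (f' := fun t => 4 * t * erf t)
        (fun t => by
          exact ((((hasDerivAt_id t).mul (hasDerivAt_exp_neg_sq t)).const_mul (2 / √π)).add
            ((((hasDerivAt_pow 2 t).const_mul 2).sub_const 1).mul (hasDerivAt_erf t))).congr_deriv
              (by simp only [id]; push_cast; ring))
        (fun t ht => by have := erf_pos ht; positivity) (by simp [erf_zero]) ht
      apply div_neg_of_neg_of_pos _ (by positivity)
      simp only [id, Pi.mul_apply]
      nlinarith [mul_pos hN (exp_pos (-t ^ 2))]
  have h := key ha hb hab
  have hp : 0 < √π := by positivity
  have e : ∀ t, costElasticity t = (t * exp (-t ^ 2) / erf t) / √π := fun t => by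
    rw [costElasticity, div_div, mul_comm (erf t)]
  rw [e, e]
  exact div_lt_div_of_pos_right h hp

lemma marginalCost_pos {t : ℝ} (ht : 0 < t) : 0 < marginalCost t := by
  unfold marginalCost; positivity

lemma marginalCost_lt {a b : ℝ} (ha : 0 < a) (hab : a < b) : marginalCost a < marginalCost b := by
  have h : exp (a ^ 2) < exp (b ^ 2) := exp_lt_exp.2 (by nlinarith)
  unfold marginalCost
  have hp : 0 < √π := by positivity
  have := ha.trans hab
  gcongr

lemma inducedRatio_lt {a b : ℝ} (ha : 0 < a) (hab : a < b) : inducedRatio a < inducedRatio b := by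
  have h1 := marginalCost_lt ha hab
  have h2 := costElasticity_lt ha hab
  have h3 := costElasticity_lt_half ha
  have h4 := marginalCost_pos ha
  unfold inducedRatio
  nlinarith

lemma inducedRatio_lt_iff {a b : ℝ} (ha : 0 < a) (hb : 0 < b) :
    inducedRatio a < inducedRatio b ↔ a < b := by
  refine ⟨fun h => ?_, inducedRatio_lt ha⟩
  by_contra! hab
  rcases hab.eq_or_lt with rfl | hab
  · exact lt_irrefl _ h
  · exact lt_asymm h (inducedRatio_lt hb hab)

lemma inducedRatio_inj {a b : ℝ} (ha : 0 < a) (hb : 0 < b)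
    (h : inducedRatio a = inducedRatio b) : a = b := by
  rcases lt_trichotomy a b with hab | hab | hab
  · exact absurd h (inducedRatio_lt ha hab).ne
  · exact hab
  · exact absurd h (inducedRatio_lt hb hab).ne'

lemma noveltyShare_lt {a b : ℝ} (ha : 0 < a) (hab : a < b) : noveltyShare a < noveltyShare b := by
  have h2 := costElasticity_lt ha hab
  have h3 := costElasticity_lt_half ha
  unfold noveltyShare
  rw [div_lt_div_iff₀ (by linarith) (by linarith)]
  nlinarith

lemma noveltyShare_le {a b : ℝ} (ha : 0 < a) (hab : a ≤ b) : noveltyShare a ≤ noveltyShare b := by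
  rcases hab.eq_or_lt with rfl | h
  · exact le_rfl
  · exact (noveltyShare_lt ha h).le

lemma third_lt_noveltyShare {t : ℝ} (ht : 0 < t) : 1 / 3 < noveltyShare t := by
  have := costElasticity_lt_half ht
  unfold noveltyShare
  rw [div_lt_div_iff₀ (by norm_num) (by linarith)]
  linarith

lemma noveltyShare_lt_half {t : ℝ} (ht : 0 < t) : noveltyShare t < 1 / 2 := by
  have := costElasticity_lt_half ht
  have := costElasticity_pos ht
  unfold noveltyShare
  rw [div_lt_div_iff₀ (by linarith) (by norm_num)]
  linarith

lemma continuousAt_noveltyShare {t : ℝ} (ht : 0 < t) : ContinuousAt noveltyShare t := by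
  have hp : √π * erf t ≠ 0 := by have := erf_pos ht; positivity
  have h : ContinuousAt costElasticity t :=
    (by fun_prop : ContinuousAt (fun t : ℝ => t * exp (-t ^ 2)) t).div
      (continuousAt_const.mul continuous_erf.continuousAt) hp
  have h2 : 2 - costElasticity t ≠ 0 := by
    have := costElasticity_lt_half ht
    linarith
  exact (continuousAt_const.sub h).div (continuousAt_const.sub h) h2

/-! ### Closed form and convexity of the benefit of a discovery -/

lemma integrable_priorValue {q : ℝ} (hq : 0 < q) :
    MeasureTheory.Integrable fun x => max ((q - priorVariance x) / q) 0 := by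
  refine Continuous.integrable_of_hasCompactSupport ?_ ?_
  · unfold priorVariance; fun_prop
  · refine HasCompactSupport.intro (isCompact_Icc (a := -q) (b := q)) fun x hx => ?_
    have : q < |x| := by
      by_contra! h
      exact hx (abs_le.1 h)
    rw [max_eq_right]
    unfold priorVariance
    exact div_nonpos_of_nonpos_of_nonneg (by linarith) hq.le

/-- To the left of `0` nothing changes, and to the right of `d` the posterior is the prior right
half translated by `d`. Those values cancel and only the bridge is left. -/
lemma benefit_eq_integral {q d : ℝ} (hq : 0 < q) (hd : 0 ≤ d) :
    benefit q d = ∫ x in (0 : ℝ)..d, max ((q - x * (d - x) / d) / q) 0 := by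
  set G : ℝ → ℝ := fun x => max ((q - priorVariance x) / q) 0 with hG
  set N : ℝ → ℝ := fun x => max ((q - x * (d - x) / d) / q) 0 with hN
  have hGi := integrable_priorValue hq
  have hNc : Continuous N := by fun_prop
  have hF : (fun x => max ((q - posteriorVariance d x) / q) 0) =
      (Set.Iic 0).indicator G + (Set.Ioc 0 d).indicator N +
        fun x => (Set.Ioi 0).indicator G (x - d) := by
    funext x
    simp only [Pi.add_apply, hG, hN, Set.indicator, Set.mem_Iic, Set.mem_Ioc, Set.mem_Ioi,
      posteriorVariance, priorVariance, sub_pos]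
    rcases le_or_gt x 0 with h0 | h0
    · have h1 : ¬ 0 < x := not_lt.2 h0
      have h2 : ¬ d < x := not_lt.2 (h0.trans hd)
      simp [h0, h1, h2, abs_of_nonpos h0]
    · have h1 : ¬ x ≤ 0 := not_le.2 h0
      rcases lt_trichotomy x d with h | h | h
      · simp [h0, h1, h, h.le, not_lt.2 h.le]
      · subst h
        simp [h0, h1]
      · simp [h0, h1, h, not_lt.2 h.le, not_le.2 h, abs_of_pos (sub_pos.2 h)]
  have hi1 : MeasureTheory.Integrable ((Set.Iic 0).indicator G) :=
    hGi.indicator measurableSet_Iic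
  have hi2 : MeasureTheory.Integrable ((Set.Ioc 0 d).indicator N) := by
    rw [MeasureTheory.integrable_indicator_iff measurableSet_Ioc]
    exact (hNc.integrableOn_Icc (a := 0) (b := d)).mono_set Set.Ioc_subset_Icc_self
  have hi3 : MeasureTheory.Integrable ((Set.Ioi 0).indicator G) :=
    hGi.indicator measurableSet_Ioi
  have hsplit : ∫ x, G x = (∫ x in Set.Iic 0, G x) + ∫ x in Set.Ioi 0, G x := by
    rw [← MeasureTheory.setIntegral_union (Set.Iic_disjoint_Ioi le_rfl) measurableSet_Ioi
      hGi.integrableOn hGi.integrableOn, Set.Iic_union_Ioi, MeasureTheory.setIntegral_univ]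
  unfold benefit valueOfKnowledge
  rw [hF, MeasureTheory.integral_add' (hi1.add hi2) (hi3.comp_sub_right d),
    MeasureTheory.integral_add' hi1 hi2, MeasureTheory.integral_sub_right_eq_self,
    MeasureTheory.integral_indicator measurableSet_Iic,
    MeasureTheory.integral_indicator measurableSet_Ioc,
    MeasureTheory.integral_indicator measurableSet_Ioi, ← hG, hsplit,
    intervalIntegral.integral_of_le hd]
  ring

/-- The integral of a conjecture's value between two answers where that value is positive. -/
lemma integral_bridgeValue {q d : ℝ} (hq : 0 < q) (hd : 0 < d) {a b : ℝ} (hab : a ≤ b)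
    (h : ∀ x ∈ Set.Icc a b, x * (d - x) ≤ d * q) :
    ∫ x in a..b, max ((q - x * (d - x) / d) / q) 0 =
      (b - b ^ 2 / (2 * q) + b ^ 3 / (3 * d * q)) - (a - a ^ 2 / (2 * q) + a ^ 3 / (3 * d * q)) := by
  have e : ∫ x in a..b, max ((q - x * (d - x) / d) / q) 0 =
      ∫ x in a..b, (1 - x / q + x ^ 2 / (d * q)) := by
    refine intervalIntegral.integral_congr fun x hx => ?_
    rw [Set.uIcc_of_le hab] at hx
    have h1 : x * (d - x) / d ≤ q := by
      rw [div_le_iff₀ hd]; linarith [h x hx]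
    rw [max_eq_left (div_nonneg (by linarith) hq.le)]
    field_simp
    ring
  rw [e]
  refine intervalIntegral.integral_eq_sub_of_hasDerivAt
    (f := fun x => x - x ^ 2 / (2 * q) + x ^ 3 / (3 * d * q)) (fun x _ => ?_)
    (Continuous.intervalIntegrable (by fun_prop) _ _)
  refine (((hasDerivAt_id x).sub ((hasDerivAt_pow 2 x).div_const _)).add
    ((hasDerivAt_pow 3 x).div_const _)).congr_deriv ?_
  push_cast
  field_simp

lemma integral_bridgeValue_zero {q d : ℝ} (hq : 0 < q) (hd : 0 < d) {a b : ℝ} (hab : a ≤ b)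
    (h : ∀ x ∈ Set.Icc a b, d * q ≤ x * (d - x)) :
    ∫ x in a..b, max ((q - x * (d - x) / d) / q) 0 = 0 := by
  rw [intervalIntegral.integral_congr (g := fun _ => (0 : ℝ)), intervalIntegral.integral_zero]
  intro x hx
  rw [Set.uIcc_of_le hab] at hx
  have h1 : q ≤ x * (d - x) / d := by
    rw [le_div_iff₀ hd]; linarith [h x hx]
  exact max_eq_right (div_nonpos_of_nonpos_of_nonneg (by linarith) hq.le)

/-- Share of the interval of length `d ≥ 4 q` that is left without a proactive action. -/
noncomputable def gapShare (q d : ℝ) : ℝ := √(1 - 4 * q / max d (4 * q))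

/-- The loss, in units of `4 q / 3`, of a discovery at distance `d ≥ 4 q` relative to `4 q`. -/
noncomputable def lossRoot (q d : ℝ) : ℝ := gapShare q d / (1 + gapShare q d)

/-- Closed form of the benefit of a discovery. -/
noncomputable def benefitFormula (q d : ℝ) : ℝ :=
  min d (4 * q) - min d (4 * q) ^ 2 / (6 * q) - 4 * q / 3 * lossRoot q d ^ 2

lemma gapShare_of_le {q d : ℝ} (hq : 0 < q) (h : d ≤ 4 * q) : gapShare q d = 0 := by
  rw [gapShare, max_eq_right h, div_self (by positivity), sub_self, sqrt_zero]

lemma lossRoot_of_le {q d : ℝ} (hq : 0 < q) (h : d ≤ 4 * q) : lossRoot q d = 0 := by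
  rw [lossRoot, gapShare_of_le hq h, zero_div]

lemma benefitFormula_of_le {q d : ℝ} (hq : 0 < q) (h : d ≤ 4 * q) :
    benefitFormula q d = d - d ^ 2 / (6 * q) := by
  rw [benefitFormula, lossRoot_of_le hq h, min_eq_left h]; ring

lemma benefitFormula_of_ge {q d : ℝ} (hq : 0 < q) (h : 4 * q ≤ d) :
    benefitFormula q d = 4 * q / 3 * (1 - lossRoot q d ^ 2) := by
  rw [benefitFormula, min_eq_right h]; field_simp; ring

lemma gapShare_nonneg (q d : ℝ) : 0 ≤ gapShare q d := sqrt_nonneg _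

lemma gapShare_sq {q d : ℝ} (hq : 0 < q) (h : 4 * q ≤ d) : d * (1 - gapShare q d ^ 2) = 4 * q := by
  have hd : 0 < d := by linarith
  rw [gapShare, max_eq_left h, sq_sqrt (sub_nonneg.2 ((div_le_one hd).2 h))]
  field_simp
  ring

lemma gapShare_lt_one {q d : ℝ} (hq : 0 < q) : gapShare q d < 1 := by
  rw [gapShare, sqrt_lt' one_pos]
  have : 0 < max d (4 * q) := lt_max_of_lt_right (by positivity)
  have : 0 < 4 * q / max d (4 * q) := by positivity
  linarith

lemma lossRoot_nonneg (q d : ℝ) : 0 ≤ lossRoot q d := by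
  have := gapShare_nonneg q d
  unfold lossRoot; positivity

lemma lossRoot_lt_half {q d : ℝ} (hq : 0 < q) : lossRoot q d < 1 / 2 := by
  have := gapShare_nonneg q d
  have := gapShare_lt_one (d := d) hq
  unfold lossRoot
  rw [div_lt_div_iff₀ (by linarith) (by norm_num)]
  linarith

/-- Distances `d ≥ 4 q` in terms of the loss root. -/
lemma mul_lossRoot {q d : ℝ} (hq : 0 < q) (h : 4 * q ≤ d) :
    d * (1 - 2 * lossRoot q d) = 4 * q * (1 - lossRoot q d) ^ 2 := by
  have h0 := gapShare_nonneg q d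
  have h1 : 1 + gapShare q d ≠ 0 := by linarith
  rw [← gapShare_sq hq h, lossRoot]
  field_simp
  ring

lemma continuous_benefitFormula {q : ℝ} (hq : 0 < q) : Continuous (benefitFormula q) := by
  have h1 : Continuous (gapShare q) := by
    unfold gapShare
    refine (continuous_const.sub (continuous_const.div (by fun_prop) fun d => ?_)).sqrt
    exact (lt_max_of_lt_right (by positivity : (0 : ℝ) < 4 * q)).ne'
  have h2 : Continuous (lossRoot q) :=
    h1.div (by fun_prop) fun d => by have := gapShare_nonneg q d; positivity
  unfold benefitFormula
  fun_prop

/-- The bridge variance peaks at `d/4`, so up to `4q` no truncation occurs. Beyond, it exceeds `q`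
exactly between the roots `d (1 ∓ r)/2` with `r = gapShare q d`, and only the two outer pieces
contribute. -/
lemma benefit_eq {q d : ℝ} (hq : 0 < q) (hd : 0 ≤ d) : benefit q d = benefitFormula q d := by
  rw [benefit_eq_integral hq hd]
  rcases hd.eq_or_lt with rfl | hd
  · rw [benefitFormula_of_le hq (by positivity)]; simp
  rcases le_or_gt d (4 * q) with h | h
  · rw [integral_bridgeValue hq hd hd.le, benefitFormula_of_le hq h]
    · field_simp; ring
    · intro x _
      nlinarith [sq_nonneg (d - 2 * x)]
  · set r := gapShare q d with hr
    have hr0 : 0 ≤ r := gapShare_nonneg q d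
    have hr1 : r < 1 := gapShare_lt_one hq
    have hrd : d * (1 - r ^ 2) = 4 * q := gapShare_sq hq h.le
    have hfac : ∀ x, d * q - x * (d - x) = (x - d * (1 - r) / 2) * (x - d * (1 + r) / 2) := by
      intro x
      linear_combination (-d / 4) * hrd
    have hc : Continuous fun x : ℝ => max ((q - x * (d - x) / d) / q) 0 := by fun_prop
    have ha : 0 ≤ d * (1 - r) / 2 := by have := sub_pos.2 hr1; positivity
    have hab : d * (1 - r) / 2 ≤ d * (1 + r) / 2 := by nlinarith
    have hb : d * (1 + r) / 2 ≤ d := by nlinarith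
    rw [← intervalIntegral.integral_add_adjacent_intervals (b := d * (1 - r) / 2)
        (hc.intervalIntegrable _ _) (hc.intervalIntegrable _ _),
      ← intervalIntegral.integral_add_adjacent_intervals (a := d * (1 - r) / 2)
        (b := d * (1 + r) / 2) (hc.intervalIntegrable _ _) (hc.intervalIntegrable _ _),
      integral_bridgeValue hq hd ha, integral_bridgeValue_zero hq hd hab,
      integral_bridgeValue hq hd hb, benefitFormula_of_ge hq h.le, lossRoot, ← hr]
    · have h1 : 1 + r ≠ 0 := by positivity
      have h2 : 1 - r ≠ 0 := (sub_pos.2 hr1).ne'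
      have hq' : q = d * (1 - r ^ 2) / 4 := by linarith
      have h3 : 1 - r ^ 2 ≠ 0 := by
        have : 1 - r ^ 2 = (1 - r) * (1 + r) := by ring
        rw [this]; exact mul_ne_zero h2 h1
      rw [hq']
      field_simp
      ring
    · intro x hx
      have := hfac x
      nlinarith [mul_nonneg (sub_nonneg.2 hx.1) (sub_nonneg.2 (hab.trans hx.1))]
    · intro x hx
      have := hfac x
      nlinarith [mul_nonneg (sub_nonneg.2 hx.1) (sub_nonneg.2 hx.2)]
    · intro x hx
      have := hfac x
      nlinarith [mul_nonneg (sub_nonneg.2 hx.2) (sub_nonneg.2 (hx.2.trans hab))]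

/-- The slope of the benefit at distances beyond `4 q`. -/
noncomputable def farSlope (q d : ℝ) : ℝ :=
  -((1 - 2 * lossRoot q d) ^ 2 / (3 * (1 - lossRoot q d)))

/-- The loss root makes both distance and benefit rational, so the gap between the benefit at `v`
and the tangent at `w` factors explicitly, with a square. This is what proves strict convexity
beyond `4q`. -/
lemma tangent_identity (q : ℝ) {v w : ℝ} (h1 : 1 - 2 * w ≠ 0) (h2 : 1 - 2 * v ≠ 0)
    (h3 : 1 - w ≠ 0) :
    4 * q / 3 * (1 - v ^ 2) - (4 * q / 3 * (1 - w ^ 2) + -((1 - 2 * w) ^ 2 / (3 * (1 - w))) *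
      (4 * q * (1 - v) ^ 2 / (1 - 2 * v) - 4 * q * (1 - w) ^ 2 / (1 - 2 * w))) =
      4 * q / 3 * ((v - w) ^ 2 * (2 * (1 - w) * v + w)) / ((1 - w) * (1 - 2 * v)) := by
  obtain ⟨a, rfl⟩ : ∃ a, w = (1 - a) / 2 := ⟨1 - 2 * w, by ring⟩
  obtain ⟨b, rfl⟩ : ∃ b, v = (1 - b) / 2 := ⟨1 - 2 * v, by ring⟩
  have ea : 1 - 2 * ((1 - a) / 2) = a := by ring
  have eb : 1 - 2 * ((1 - b) / 2) = b := by ring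
  have ec : 1 - (1 - a) / 2 = (1 + a) / 2 := by ring
  rw [ea] at h1
  rw [eb] at h2
  rw [ec] at h3
  have h4 : 1 + a ≠ 0 := fun h => h3 (by rw [h]; simp)
  rw [ea, eb, ec]
  field_simp
  ring

/-- Beyond `4 q` the benefit is strictly convex. -/
lemma tangent_lt_benefitFormula {q x y : ℝ} (hq : 0 < q) (hx : 4 * q ≤ x) (hy : 4 * q ≤ y)
    (hxy : y ≠ x) :
    benefitFormula q x + farSlope q x * (y - x) < benefitFormula q y := by
  have ex := mul_lossRoot hq hx
  have ey := mul_lossRoot hq hy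
  have hw0 := lossRoot_nonneg q x
  have hv0 := lossRoot_nonneg q y
  have hw1 := lossRoot_lt_half (d := x) hq
  have hv1 := lossRoot_lt_half (d := y) hq
  rw [benefitFormula_of_ge hq hx, benefitFormula_of_ge hq hy, farSlope]
  set w := lossRoot q x
  set v := lossRoot q y
  have h1 : 0 < 1 - 2 * w := by linarith
  have h2 : 0 < 1 - 2 * v := by linarith
  have h3 : 0 < 1 - w := by linarith
  have hx' : x = 4 * q * (1 - w) ^ 2 / (1 - 2 * w) := by
    rw [eq_div_iff h1.ne']; exact ex
  have hy' : y = 4 * q * (1 - v) ^ 2 / (1 - 2 * v) := by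
    rw [eq_div_iff h2.ne']; exact ey
  have hne : v ≠ w := fun h => hxy (by rw [hx', hy', h])
  have key := tangent_identity q h1.ne' h2.ne' h3.ne'
  rw [← hx', ← hy'] at key
  have hpos : 0 < 2 * (1 - w) * v + w := by
    rcases hw0.eq_or_lt with h | h
    · have : 0 < v := lt_of_le_of_ne hv0 fun h' => hne (by rw [← h', ← h])
      rw [← h]; linarith
    · positivity
  have : 0 < (v - w) ^ 2 := by
    have := sub_ne_zero.2 hne
    positivity
  have : 0 < 4 * q / 3 * ((v - w) ^ 2 * (2 * (1 - w) * v + w)) / ((1 - w) * (1 - 2 * v)) := by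
    positivity
  linarith

lemma farSlope_neg {q d : ℝ} (hq : 0 < q) : farSlope q d < 0 := by
  have h := lossRoot_lt_half (d := d) hq
  unfold farSlope
  have h1 : 0 < 1 - 2 * lossRoot q d := by linarith
  have h3 : 0 < 1 - lossRoot q d := by linarith
  rw [neg_lt_zero]
  positivity

lemma benefitFormula_strictAnti {q x y : ℝ} (hq : 0 < q) (hx : 4 * q ≤ x) (hxy : x < y) :
    benefitFormula q y < benefitFormula q x := by
  have h := tangent_lt_benefitFormula hq (hx.trans hxy.le) hx hxy.ne
  nlinarith [farSlope_neg (d := y) hq]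

lemma benefitFormula_le_of_ge {q d : ℝ} (hq : 0 < q) (hd : 4 * q ≤ d) :
    benefitFormula q d ≤ 4 * q / 3 := by
  rw [benefitFormula_of_ge hq hd]
  nlinarith [mul_nonneg hq.le (sq_nonneg (lossRoot q d))]

lemma benefitFormula_le_self {q d : ℝ} (hq : 0 < q) : benefitFormula q d ≤ d := by
  rcases le_or_gt d (4 * q) with h | h
  · rw [benefitFormula_of_le hq h]
    have : 0 ≤ d ^ 2 / (6 * q) := by positivity
    linarith
  · linarith [benefitFormula_le_of_ge hq h.le]

/-- The benefit is maximal at distance `3 q`. -/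
lemma benefitFormula_le {q d : ℝ} (hq : 0 < q) : benefitFormula q d ≤ 3 * q / 2 := by
  rcases le_or_gt d (4 * q) with h | h
  · rw [benefitFormula_of_le hq h, sub_le_iff_le_add, ← sub_le_iff_le_add', le_div_iff₀ (by positivity)]
    nlinarith [sq_nonneg (d - 3 * q)]
  · linarith [benefitFormula_le_of_ge hq h.le]

lemma benefitFormula_pos {q d : ℝ} (hq : 0 < q) (hd : 0 < d) : 0 < benefitFormula q d := by
  rcases le_or_gt d (4 * q) with h | h
  · rw [benefitFormula_of_le hq h, sub_pos, div_lt_iff₀ (by positivity)]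
    nlinarith
  · rw [benefitFormula_of_ge hq h.le]
    have h1 := lossRoot_nonneg q d
    have h2 := lossRoot_lt_half (d := d) hq
    have : 0 < 1 - lossRoot q d ^ 2 := by nlinarith
    positivity

/-! ### The researcher's problem in the variables `d` and `t` -/

namespace Env

/-- The cost parameter under the scheme with reward `ζ`. -/
noncomputable def cost (E : Env) (ζ : ℝ) : ℝ := E.η₀ - (E.K - ζ) / E.κ

/-- The marginal benefit of a small distance under the scheme with reward `ζ`. -/
noncomputable def reach (E : Env) (ζ : ℝ) : ℝ := 1 + ζ / E.s

lemma s_pos (E : Env) : 0 < E.s := by linarith [E.q_pos, E.s_ge]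

lemma κ_pos (E : Env) : 0 < E.κ := (div_nonneg E.K_nonneg E.η₀_pos.le).trans_lt E.κ_gt

lemma cost_eq (E : Env) (ζ : ℝ) : E.cost ζ = E.cost 0 + ζ / E.κ := by
  unfold cost; ring

lemma cost_zero_pos (E : Env) : 0 < E.cost 0 := by
  have h := E.κ_gt
  rw [div_lt_iff₀ E.η₀_pos] at h
  unfold cost
  rw [sub_zero, sub_pos, div_lt_iff₀ E.κ_pos]
  linarith

lemma cost_zero_le (E : Env) {ζ : ℝ} (hζ : 0 ≤ ζ) : E.cost 0 ≤ E.cost ζ := by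
  rw [E.cost_eq ζ]
  have := div_nonneg hζ E.κ_pos.le
  linarith

lemma cost_pos (E : Env) {ζ : ℝ} (hζ : 0 ≤ ζ) : 0 < E.cost ζ :=
  E.cost_zero_pos.trans_le (E.cost_zero_le hζ)

lemma one_le_reach (E : Env) {ζ : ℝ} (hζ : 0 ≤ ζ) : 1 ≤ E.reach ζ := by
  have := div_nonneg hζ E.s_pos.le
  unfold reach; linarith

lemma reach_pos (E : Env) {ζ : ℝ} (hζ : 0 ≤ ζ) : 0 < E.reach ζ :=
  one_pos.trans_le (E.one_le_reach hζ)

lemma reach_lt (E : Env) {a b : ℝ} (h : a < b) : E.reach a < E.reach b := by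
  unfold reach
  have := div_lt_div_of_pos_right h E.s_pos
  linarith

end Env

/-- The researcher's reward for a success at distance `d`. -/
noncomputable def successReward (E : Env) (ζ d : ℝ) : ℝ :=
  benefitFormula E.q d + min (d / E.s) 1 * ζ

/-- The researcher's payoff at distance `d` and output `erf t`. -/
noncomputable def profit (E : Env) (ζ d t : ℝ) : ℝ :=
  erf t * successReward E ζ d - E.cost ζ * (t ^ 2 * d)

/-- Distance `d` and output `erf t` solve the researcher's problem under reward `ζ`. -/
def IsChoice (E : Env) (ζ d t : ℝ) : Prop :=
  0 ≤ d ∧ 0 ≤ t ∧ ∀ d' t' : ℝ, 0 ≤ d' → 0 ≤ t' → profit E ζ d' t' ≤ profit E ζ d t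

lemma rewardProb_abs (E : Env) {d : ℝ} (hd : 0 ≤ d) :
    rewardProb E.s (priorVariance d) = min (d / E.s) 1 := by
  rw [rewardProb, priorVariance, abs_of_nonneg hd]
  split_ifs with h
  · exact (min_eq_left ((div_le_one E.s_pos).2 h.le)).symm
  · exact (min_eq_right ((one_le_div E.s_pos).2 (not_lt.1 h))).symm

lemma IsScheme.cost_eq {E : Env} {ζ h : ℝ} (hs : IsScheme E ζ h) : E.cost ζ = E.η₀ - h := by
  have := E.κ_pos.ne'
  have h3 := hs.2.2
  rw [Env.cost, ← h3]
  field_simp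
  ring

lemma IsScheme.mem_Icc {E : Env} {ζ h : ℝ} (hs : IsScheme E ζ h) : ζ ∈ Set.Icc 0 E.K :=
  ⟨hs.1, by nlinarith [hs.2.2, mul_nonneg E.κ_pos.le hs.2.1]⟩

lemma isScheme_of_mem {E : Env} {ζ : ℝ} (h : ζ ∈ Set.Icc 0 E.K) :
    IsScheme E ζ ((E.K - ζ) / E.κ) :=
  ⟨h.1, div_nonneg (sub_nonneg.2 h.2) E.κ_pos.le, by
    rw [mul_div_cancel₀ _ E.κ_pos.ne']; ring⟩

lemma researcherPayoff_eq {E : Env} {ζ h d : ℝ} (hs : IsScheme E ζ h) (hd : 0 ≤ d) (t : ℝ) :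
    researcherPayoff E ζ h d (erf t) = profit E ζ d t := by
  rw [researcherPayoff, profit, successReward, rewardProb_abs E hd, benefit_eq E.q_pos hd,
    hs.cost_eq, costFactor, erfInv_erf, priorVariance, abs_of_nonneg hd]

lemma erf_mem_Ico {t : ℝ} (ht : 0 ≤ t) : erf t ∈ Set.Ico (0 : ℝ) 1 :=
  ⟨erf_nonneg ht, erf_lt_one t⟩

/-- `erf` maps `[0, ∞)` onto `[0, 1)` and `erfInv` undoes it, so nothing is lost by optimizing over
`t`. -/
lemma isResearcherChoice_iff {E : Env} {ζ h d ρ : ℝ} (hs : IsScheme E ζ h) :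
    IsResearcherChoice E ζ h d ρ ↔ ∃ t, erf t = ρ ∧ IsChoice E ζ d t := by
  constructor
  · rintro ⟨hd, hρ, H⟩
    obtain ⟨t, ht, rfl⟩ := exists_erf_eq hρ
    refine ⟨t, rfl, hd, ht, fun d' t' hd' ht' => ?_⟩
    have := H d' (erf t') hd' (erf_mem_Ico ht')
    rwa [researcherPayoff_eq hs hd', researcherPayoff_eq hs hd] at this
  · rintro ⟨t, rfl, hd, ht, H⟩
    refine ⟨hd, erf_mem_Ico ht, fun d' ρ' hd' hρ' => ?_⟩
    obtain ⟨t', ht', rfl⟩ := exists_erf_eq hρ'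
    rw [researcherPayoff_eq hs hd', researcherPayoff_eq hs hd]
    exact H d' t' hd' ht'

lemma implementable_iff {E : Env} {d ρ : ℝ} :
    Implementable E d ρ ↔ ∃ ζ ∈ Set.Icc 0 E.K, ∃ t, erf t = ρ ∧ IsChoice E ζ d t := by
  constructor
  · rintro ⟨ζ, h, hs, hc⟩
    exact ⟨ζ, hs.mem_Icc, (isResearcherChoice_iff hs).1 hc⟩
  · rintro ⟨ζ, hζ, hc⟩
    exact ⟨ζ, _, isScheme_of_mem hζ, (isResearcherChoice_iff (isScheme_of_mem hζ)).2 hc⟩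

lemma IsChoice.implementable {E : Env} {ζ d t : ℝ} (h : IsChoice E ζ d t)
    (hζ : ζ ∈ Set.Icc 0 E.K) : Implementable E d (erf t) :=
  implementable_iff.2 ⟨ζ, hζ, t, rfl, h⟩

/-- The funder's payoff. -/
noncomputable def funderPayoff (E : Env) (d t : ℝ) : ℝ := erf t * benefitFormula E.q d

lemma IsOptimalFunding.exists_isChoice {E : Env} {ζ h d ρ : ℝ} (H : IsOptimalFunding E ζ h d ρ) :
    ζ ∈ Set.Icc 0 E.K ∧ ∃ t, erf t = ρ ∧ IsChoice E ζ d t ∧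
      ∀ ζ' ∈ Set.Icc 0 E.K, ∀ d' t', IsChoice E ζ' d' t' →
        funderPayoff E d' t' ≤ funderPayoff E d t := by
  obtain ⟨hs, hc, hopt⟩ := H
  obtain ⟨t, rfl, hct⟩ := (isResearcherChoice_iff hs).1 hc
  refine ⟨hs.mem_Icc, t, rfl, hct, fun ζ' hζ' d' t' h' => ?_⟩
  have := hopt _ _ (h'.implementable hζ')
  rwa [benefit_eq E.q_pos h'.1, benefit_eq E.q_pos hct.1] at this

lemma successReward_le {E : Env} {ζ d : ℝ} (hζ : 0 ≤ ζ) :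
    successReward E ζ d ≤ d * E.reach ζ := by
  have h1 := benefitFormula_le_self (d := d) E.q_pos
  have h2 : min (d / E.s) 1 * ζ ≤ d / E.s * ζ :=
    mul_le_mul_of_nonneg_right (min_le_left _ _) hζ
  unfold successReward Env.reach
  have : d * (1 + ζ / E.s) = d + d / E.s * ζ := by ring
  linarith

lemma successReward_pos {E : Env} {ζ d : ℝ} (hζ : 0 ≤ ζ) (hd : 0 < d) :
    0 < successReward E ζ d := by
  have h1 := benefitFormula_pos E.q_pos hd
  have h2 : 0 ≤ min (d / E.s) 1 := le_min (div_nonneg hd.le E.s_pos.le) one_pos.le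
  unfold successReward
  positivity

lemma successReward_of_lt {E : Env} {ζ d : ℝ} (hd : d ≤ 4 * E.q) :
    successReward E ζ d = d * (E.reach ζ - d / (6 * E.q)) := by
  have h2 : d / E.s ≤ 1 := (div_le_one E.s_pos).2 (hd.trans E.s_ge)
  rw [successReward, benefitFormula_of_le E.q_pos hd, min_eq_left h2, Env.reach]
  ring

lemma successReward_cap {E : Env} {ζ d : ℝ} (hd : d ≤ E.s) :
    successReward E ζ d = benefitFormula E.q d + d / E.s * ζ := by
  rw [successReward, min_eq_left ((div_le_one E.s_pos).2 hd)]

lemma successReward_of_ge {E : Env} {ζ d : ℝ} (hd : E.s ≤ d) :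
    successReward E ζ d = benefitFormula E.q d + ζ := by
  rw [successReward, min_eq_right ((one_le_div E.s_pos).2 hd), one_mul]

/-- At zero effort the return is of first order in `t` while the cost is of second order. This
excludes corner choices. -/
lemma exists_profit_pos {E : Env} {ζ d : ℝ} (hζ : 0 ≤ ζ) (hd : 0 < d) :
    ∃ t, 0 < t ∧ 0 < profit E ζ d t := by
  have hW := successReward_pos (E := E) hζ hd
  have hη := E.cost_pos hζ
  have hc : 0 < 2 / √π := two_div_sqrt_pi_pos
  have h1 : HasDerivAt (profit E ζ d) (2 / √π * successReward E ζ d) 0 := by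
    refine (((hasDerivAt_erf 0).mul_const _).sub
      (((hasDerivAt_pow 2 (0 : ℝ)).mul_const d).const_mul (E.cost ζ))).congr_deriv ?_
    simp
  have h0 : profit E ζ d 0 = 0 := by simp [profit, erf_zero]
  by_contra! H
  have h2 : 2 / √π * successReward E ζ d ≤ 0 := by
    have h3 := h1.hasDerivWithinAt (s := Set.Ioi 0)
    rw [hasDerivWithinAt_iff_tendsto_slope' (by simp)] at h3
    refine le_of_tendsto h3 ?_
    filter_upwards [self_mem_nhdsWithin] with t ht
    rw [slope_def_field, h0]
    have := H t ht
    exact div_nonpos_of_nonpos_of_nonneg (by linarith) (by simpa using le_of_lt ht)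
  have : 0 < 2 / √π * successReward E ζ d := by positivity
  linarith

/-! ### First-order conditions and the location of the researcher's choice -/

section Choice

lemma IsChoice.profit_pos {E : Env} {ζ d t : ℝ} (h : IsChoice E ζ d t) (hζ : 0 ≤ ζ) :
    0 < profit E ζ d t := by
  obtain ⟨t', ht', h'⟩ := exists_profit_pos hζ E.q_pos
  exact h'.trans_le (h.2.2 _ _ E.q_pos.le ht'.le)

lemma IsChoice.dist_pos {E : Env} {ζ d t : ℝ} (h : IsChoice E ζ d t) (hζ : 0 ≤ ζ) : 0 < d := by
  refine lt_of_le_of_ne h.1 fun h0 => ?_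
  have := h.profit_pos hζ
  rw [← h0, profit, successReward_cap E.s_pos.le,
    benefitFormula_of_le E.q_pos (by linarith [E.q_pos])] at this
  simp at this

lemma IsChoice.effort_pos {E : Env} {ζ d t : ℝ} (h : IsChoice E ζ d t) (hζ : 0 ≤ ζ) : 0 < t := by
  refine lt_of_le_of_ne h.2.1 fun h0 => ?_
  have := h.profit_pos hζ
  rw [← h0, profit, erf_zero] at this
  simp at this

/-- First-order condition for output. -/
lemma IsChoice.successReward_eq {E : Env} {ζ d t : ℝ} (h : IsChoice E ζ d t) (hζ : 0 ≤ ζ) :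
    successReward E ζ d = E.cost ζ * d * marginalCost t := by
  have ht := h.effort_pos hζ
  have h1 : HasDerivAt (profit E ζ d)
      (2 / √π * exp (-t ^ 2) * successReward E ζ d - E.cost ζ * (2 * t * d)) t := by
    refine (((hasDerivAt_erf t).mul_const _).sub
      (((hasDerivAt_pow 2 t).mul_const d).const_mul (E.cost ζ))).congr_deriv ?_
    push_cast; ring
  have hmax : IsLocalMax (profit E ζ d) t := by
    filter_upwards [lt_mem_nhds ht] with t' ht' using h.2.2 d t' h.1 ht'.le
  have h0 := hmax.hasDerivAt_eq_zero h1
  have hp : 0 < √π := by positivity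
  have he : exp (-t ^ 2) * exp (t ^ 2) = 1 := by rw [← exp_add]; simp
  unfold marginalCost
  have h2 : exp (-t ^ 2) * successReward E ζ d = E.cost ζ * t * d * √π := by
    field_simp at h0
    linarith
  calc successReward E ζ d = (exp (-t ^ 2) * exp (t ^ 2)) * successReward E ζ d := by
        rw [he, one_mul]
    _ = exp (t ^ 2) * (exp (-t ^ 2) * successReward E ζ d) := by ring
    _ = _ := by rw [h2]; ring

lemma IsChoice.dist_le_cap {E : Env} {ζ d t : ℝ} (h : IsChoice E ζ d t) (hζ : 0 ≤ ζ) :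
    d ≤ E.s := by
  by_contra! hd
  have h1 := benefitFormula_strictAnti E.q_pos E.s_ge hd
  have h2 := erf_pos (h.effort_pos hζ)
  have h3 := h.2.2 E.s t E.s_pos.le h.2.1
  rw [profit, profit, successReward_of_ge hd.le, successReward_of_ge le_rfl] at h3
  have h4 : t ^ 2 * E.s ≤ t ^ 2 * d := by gcongr
  have h5 := mul_le_mul_of_nonneg_left h4 (E.cost_pos hζ).le
  nlinarith

/-- The researcher never chooses a distance between `4 q` and the reward cap. -/
lemma IsChoice.lt_or_eq_cap {E : Env} {ζ d t : ℝ} (h : IsChoice E ζ d t) (hζ : 0 ≤ ζ) :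
    d < 4 * E.q ∨ d = E.s := by
  by_contra! H
  obtain ⟨hd, hne⟩ := H
  have hds : d < E.s := lt_of_le_of_ne (h.dist_le_cap hζ) hne
  have hq := E.q_pos
  have hρ := erf_pos (h.effort_pos hζ)
  have hopt : ∀ y, 0 ≤ y → y ≤ E.s →
      erf t * (benefitFormula E.q y + y / E.s * ζ) - E.cost ζ * (t ^ 2 * y) ≤
      erf t * (benefitFormula E.q d + d / E.s * ζ) - E.cost ζ * (t ^ 2 * d) := fun y hy hys => by
    have := h.2.2 y t hy h.2.1
    rwa [profit, profit, successReward_cap hys, successReward_cap hds.le] at this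
  -- `m` is the slope of the payoff in novelty at fixed output. By strict convexity the payoff lies
  -- above its tangent, so optimality against `s` forces `m < 0`; stepping back towards `4q` would
  -- then pay.
  set m := erf t * (farSlope E.q d + ζ / E.s) - E.cost ζ * t ^ 2 with hm
  have htan : ∀ y, benefitFormula E.q d + farSlope E.q d * (y - d) < benefitFormula E.q y →
      0 ≤ y → y ≤ E.s → m * (y - d) < 0 := fun y hy hy0 hys => by
    have h1 := hopt y hy0 hys
    have h2 := mul_lt_mul_of_pos_left hy hρ
    have : m * (y - d) = erf t * (benefitFormula E.q d + farSlope E.q d * (y - d)) -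
        erf t * benefitFormula E.q d + (erf t * (y / E.s * ζ) - erf t * (d / E.s * ζ)) -
        (E.cost ζ * (t ^ 2 * y) - E.cost ζ * (t ^ 2 * d)) := by
      rw [hm]; ring
    linarith
  have hm0 : m < 0 := by
    have := htan E.s (tangent_lt_benefitFormula hq hd E.s_ge hds.ne') E.s_pos.le le_rfl
    nlinarith
  rcases hd.eq_or_lt with hd' | hd'
  -- At exactly `4q` convexity gives no room to the left. But the left derivative is also `-1/3`, so
  -- a step back by `ε` gains `-m ε` and loses only order `ε²`.
  · have hs : farSlope E.q d = -(1 / 3) := by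
      rw [farSlope, lossRoot_of_le hq hd'.ge]; norm_num
    have hb : ∀ ε, 0 < ε → ε ≤ 4 * E.q → -m ≤ erf t * (ε / (6 * E.q)) := fun ε hε hε4 => by
      have h1 := hopt (d - ε) (by linarith) (by linarith)
      rw [benefitFormula_of_le hq (by linarith : d - ε ≤ 4 * E.q),
        benefitFormula_of_le hq hd'.ge] at h1
      have h2 : (-m) * ε ≤ erf t * (ε / (6 * E.q)) * ε := by
        have e : erf t * (ε / (6 * E.q)) * ε - (-m) * ε =
            (erf t * (d - d ^ 2 / (6 * E.q) + d / E.s * ζ) - E.cost ζ * (t ^ 2 * d)) -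
            (erf t * (d - ε - (d - ε) ^ 2 / (6 * E.q) + (d - ε) / E.s * ζ) -
              E.cost ζ * (t ^ 2 * (d - ε))) := by
          rw [hm, hs, ← hd']
          field_simp
          ring
        linarith
      exact le_of_mul_le_mul_right h2 hε
    have h3 : ∀ᶠ ε : ℝ in nhdsWithin 0 (Set.Ioi 0), -m ≤ erf t * (ε / (6 * E.q)) := by
      filter_upwards [Ioc_mem_nhdsGT (by positivity : (0 : ℝ) < 4 * E.q)] with ε hε
        using hb ε hε.1 hε.2
    have h4 : Filter.Tendsto (fun ε : ℝ => erf t * (ε / (6 * E.q)))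
        (nhdsWithin 0 (Set.Ioi 0)) (nhds (erf t * (0 / (6 * E.q)))) :=
      (Continuous.tendsto (by fun_prop) 0).mono_left nhdsWithin_le_nhds
    have := ge_of_tendsto h4 h3
    simp at this
    linarith
  · have := htan (4 * E.q) (tangent_lt_benefitFormula hq hd le_rfl hd'.ne) (by linarith) E.s_ge
    nlinarith

/-- This links the novelty condition, which involves `t² / erf t`, to the output condition, which
involves `marginalCost t`. -/
lemma costElasticity_mul {t : ℝ} (ht : 0 < t) :
    costElasticity t * marginalCost t * erf t = t ^ 2 := by
  have h := (erf_pos ht).ne'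
  have hp : √π ≠ 0 := by positivity
  have he : exp (-t ^ 2) * exp (t ^ 2) = 1 := by rw [← exp_add]; simp
  unfold costElasticity marginalCost
  field_simp
  linear_combination he

/-- First-order condition for an interior distance. -/
lemma IsChoice.effort_sq_eq {E : Env} {ζ d t : ℝ} (h : IsChoice E ζ d t) (hζ : 0 ≤ ζ)
    (hd : d < 4 * E.q) :
    erf t * (E.reach ζ - d / (3 * E.q)) = E.cost ζ * t ^ 2 := by
  have hd0 := h.dist_pos hζ
  have h1 : HasDerivAt (fun y => erf t * (y * (E.reach ζ - y / (6 * E.q))) - E.cost ζ * (t ^ 2 * y))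
      (erf t * (E.reach ζ - d / (3 * E.q)) - E.cost ζ * t ^ 2) d := by
    refine ((((hasDerivAt_id d).mul (((hasDerivAt_id d).div_const (6 * E.q)).const_sub
      (E.reach ζ))).const_mul (erf t)).sub
      (((hasDerivAt_id d).const_mul (t ^ 2)).const_mul (E.cost ζ))).congr_deriv ?_
    have := E.q_pos.ne'
    simp only [id]
    field_simp
    ring
  have hmax : IsLocalMax (fun y => erf t * (y * (E.reach ζ - y / (6 * E.q))) -
      E.cost ζ * (t ^ 2 * y)) d := by
    filter_upwards [lt_mem_nhds hd0, gt_mem_nhds hd] with y hy0 hy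
    have := h.2.2 y t hy0.le h.2.1
    rwa [profit, profit, successReward_of_lt hy.le, successReward_of_lt hd.le] at this
  linarith [hmax.hasDerivAt_eq_zero h1]

lemma IsChoice.reach_sub_eq {E : Env} {ζ d t : ℝ} (h : IsChoice E ζ d t) (hζ : 0 ≤ ζ)
    (hd : d < 4 * E.q) :
    E.reach ζ - d / (6 * E.q) = E.cost ζ * marginalCost t := by
  have h1 := h.successReward_eq hζ
  rw [successReward_of_lt hd.le] at h1
  exact mul_left_cancel₀ (h.dist_pos hζ).ne' (by linarith)

lemma IsChoice.reach_sub_eq' {E : Env} {ζ d t : ℝ} (h : IsChoice E ζ d t) (hζ : 0 ≤ ζ)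
    (hd : d < 4 * E.q) :
    E.reach ζ - d / (3 * E.q) = E.cost ζ * (costElasticity t * marginalCost t) := by
  have h1 := h.effort_sq_eq hζ hd
  have ht := h.effort_pos hζ
  rw [← costElasticity_mul ht] at h1
  exact mul_left_cancel₀ (erf_pos ht).ne' (by linarith)

/-- Twice the output condition minus the novelty condition eliminates `d`. -/
lemma IsChoice.inducedRatio_eq {E : Env} {ζ d t : ℝ} (h : IsChoice E ζ d t) (hζ : 0 ≤ ζ)
    (hd : d < 4 * E.q) : inducedRatio t = E.reach ζ / E.cost ζ := by
  have h1 := h.reach_sub_eq hζ hd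
  have h2 := h.reach_sub_eq' hζ hd
  rw [eq_div_iff (E.cost_pos hζ).ne', inducedRatio]
  have : d / (3 * E.q) = 2 * (d / (6 * E.q)) := by
    have := E.q_pos.ne'
    field_simp; ring
  linarith

lemma IsChoice.dist_eq {E : Env} {ζ d t : ℝ} (h : IsChoice E ζ d t) (hζ : 0 ≤ ζ)
    (hd : d < 4 * E.q) : d = 6 * E.q * E.reach ζ * noveltyShare t := by
  have h1 := h.reach_sub_eq hζ hd
  have h3 := h.inducedRatio_eq hζ hd
  have h4 := costElasticity_lt_half (h.effort_pos hζ)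
  rw [eq_div_iff (E.cost_pos hζ).ne', inducedRatio] at h3
  have h5 : 2 - costElasticity t ≠ 0 := by linarith
  have h6 : d / (6 * E.q) = E.reach ζ * noveltyShare t := by
    rw [noveltyShare, mul_div_assoc', eq_div_iff h5]
    linear_combination (-(2 - costElasticity t)) * h1 + (-1 : ℝ) * h3
  have := E.q_pos
  rw [div_eq_iff (by positivity)] at h6
  linarith

lemma IsChoice.profit_eq {E : Env} {ζ d t : ℝ} (h : IsChoice E ζ d t) (hζ : 0 ≤ ζ) :
    profit E ζ d t = E.cost ζ * (d * (erf t * marginalCost t - t ^ 2)) := by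
  rw [profit, h.successReward_eq hζ]; ring

lemma IsChoice.effort_sq_le {E : Env} {ζ d t : ℝ} (h : IsChoice E ζ d t) (hζ : 0 ≤ ζ) :
    E.cost ζ * t ^ 2 ≤ E.reach ζ := by
  have h1 := h.profit_pos hζ
  have hd := h.dist_pos hζ
  have h2 := successReward_le (E := E) (d := d) hζ
  have h3 := successReward_pos (E := E) hζ hd
  have h4 := erf_lt_one t
  rw [profit] at h1
  have : E.cost ζ * t ^ 2 * d ≤ E.reach ζ * d := by nlinarith
  exact le_of_mul_le_mul_right this hd

end Choice

/-! ### Compactness: existence of choices, optimal funding and frontier points -/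

lemma continuous_profit (E : Env) :
    Continuous fun p : ℝ × ℝ × ℝ => profit E p.1 p.2.1 p.2.2 := by
  have h1 := continuous_benefitFormula E.q_pos
  have h2 := continuous_erf
  unfold profit successReward Env.cost
  fun_prop

lemma profit_le_zero_of_effort {E : Env} {ζ d t : ℝ} (hζ : 0 ≤ ζ) (hd : 0 ≤ d)
    (ht : E.reach ζ ≤ E.cost ζ * t ^ 2) : profit E ζ d t ≤ 0 := by
  have h2 := successReward_le (E := E) (d := d) hζ
  have h4 := erf_lt_one t
  rw [profit]
  rcases hd.eq_or_lt with rfl | hd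
  · rw [successReward_cap E.s_pos.le, benefitFormula_of_le E.q_pos (by linarith [E.q_pos])]
    simp
  · have h3 := successReward_pos (E := E) hζ hd
    nlinarith

/-- Effort with `cost * t² ≥ reach` never earns a positive payoff, and distances beyond the cap are
dominated by the cap, so a compact box suffices. -/
lemma exists_isChoice (E : Env) {ζ : ℝ} (hζ : 0 ≤ ζ) : ∃ d t, IsChoice E ζ d t := by
  have hη := E.cost_pos hζ
  set T := √(E.reach ζ / E.cost ζ) with hT
  have hT2 : E.cost ζ * T ^ 2 = E.reach ζ := by
    rw [hT, sq_sqrt (div_nonneg (E.reach_pos hζ).le hη.le)]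
    field_simp
  have hT0 : 0 ≤ T := sqrt_nonneg _
  have hc : Continuous fun p : ℝ × ℝ => profit E ζ p.1 p.2 :=
    (continuous_profit E).comp (Continuous.prodMk_right ζ)
  obtain ⟨⟨d, t⟩, ⟨hd, ht⟩, hmax⟩ := ((isCompact_Icc (a := 0) (b := E.s)).prod
    (isCompact_Icc (a := 0) (b := T))).exists_isMaxOn
    ⟨(0, 0), ⟨le_rfl, E.s_pos.le⟩, ⟨le_rfl, hT0⟩⟩ hc.continuousOn
  refine ⟨d, t, hd.1, ht.1, fun d' t' hd' ht' => ?_⟩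
  have key : ∀ d'', 0 ≤ d'' → d'' ≤ E.s → profit E ζ d'' t' ≤ profit E ζ d t := fun d'' h0 h1 => by
    rcases le_total t' T with h | h
    · exact isMaxOn_iff.1 hmax (d'', t') ⟨⟨h0, h1⟩, ⟨ht', h⟩⟩
    · have h2 : profit E ζ d'' t' ≤ 0 := profit_le_zero_of_effort hζ h0 (by
        rw [← hT2]; gcongr)
      have h3 : profit E ζ 0 0 ≤ profit E ζ d t :=
        isMaxOn_iff.1 hmax (0, 0) ⟨⟨le_rfl, E.s_pos.le⟩, ⟨le_rfl, hT0⟩⟩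
      have h4 : profit E ζ 0 0 = 0 := by simp [profit, erf_zero]
      linarith
  rcases le_total d' E.s with h | h
  · exact key d' hd' h
  · refine le_trans ?_ (key E.s E.s_pos.le le_rfl)
    rw [profit, profit, successReward_of_ge h, successReward_of_ge le_rfl]
    have h1 : benefitFormula E.q d' ≤ benefitFormula E.q E.s := by
      rcases h.eq_or_lt with h | h
      · rw [h]
      · exact (benefitFormula_strictAnti E.q_pos E.s_ge h).le
    have h2 := erf_nonneg ht'
    have h3 : E.cost ζ * (t' ^ 2 * E.s) ≤ E.cost ζ * (t' ^ 2 * d') := by gcongr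
    nlinarith

/-- The schemes together with the researcher's choices form a compact set. -/
lemma isCompact_choices (E : Env) :
    IsCompact {p : ℝ × ℝ × ℝ | p.1 ∈ Set.Icc 0 E.K ∧ IsChoice E p.1 p.2.1 p.2.2} := by
  set T := √(E.reach E.K / E.cost 0) with hT
  refine IsCompact.of_isClosed_subset ((isCompact_Icc (a := 0) (b := E.K)).prod
    ((isCompact_Icc (a := 0) (b := E.s)).prod (isCompact_Icc (a := 0) (b := T)))) ?_ ?_
  · have hc := continuous_profit E
    have e : {p : ℝ × ℝ × ℝ | p.1 ∈ Set.Icc 0 E.K ∧ IsChoice E p.1 p.2.1 p.2.2} =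
        {p | 0 ≤ p.1} ∩ {p | p.1 ≤ E.K} ∩ {p | 0 ≤ p.2.1} ∩ {p | 0 ≤ p.2.2} ∩
        ⋂ (d' : ℝ) (t' : ℝ) (_ : 0 ≤ d') (_ : 0 ≤ t'),
          {p | profit E p.1 d' t' ≤ profit E p.1 p.2.1 p.2.2} := by
      ext p
      simp only [IsChoice, Set.mem_ofPred_eq, Set.mem_inter_iff, Set.mem_iInter, Set.mem_Icc]
      tauto
    rw [e]
    refine (((isClosed_le (by fun_prop) (by fun_prop)).inter
      (isClosed_le (by fun_prop) (by fun_prop))).inter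
      (isClosed_le (by fun_prop) (by fun_prop))).inter
      (isClosed_le (by fun_prop) (by fun_prop)) |>.inter ?_
    refine isClosed_iInter fun d' => isClosed_iInter fun t' => isClosed_iInter fun _ =>
      isClosed_iInter fun _ => isClosed_le ?_ hc
    exact hc.comp (by fun_prop : Continuous fun p : ℝ × ℝ × ℝ => (p.1, d', t'))
  · rintro ⟨ζ, d, t⟩ ⟨hζ, h⟩
    refine ⟨hζ, ⟨h.1, h.dist_le_cap hζ.1⟩, ⟨h.2.1, le_sqrt_of_sq_le ?_⟩⟩
    have h1 := h.effort_sq_le hζ.1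
    have h2 := E.cost_zero_le hζ.1
    rw [le_div_iff₀ E.cost_zero_pos]
    have h3 : E.reach ζ ≤ E.reach E.K := by
      rcases hζ.2.eq_or_lt with h | h
      · exact le_of_eq (congrArg E.reach h)
      · exact (E.reach_lt h).le
    simp only at h1 ⊢
    nlinarith [sq_nonneg t]

lemma exists_isOptimalFunding (E : Env) : ∃ ζ h d ρ, IsOptimalFunding E ζ h d ρ := by
  have h1 := continuous_benefitFormula E.q_pos
  have h2 := continuous_erf
  have hc : Continuous fun p : ℝ × ℝ × ℝ => funderPayoff E p.2.1 p.2.2 := by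
    unfold funderPayoff; fun_prop
  obtain ⟨d₀, t₀, h₀⟩ := exists_isChoice E le_rfl
  obtain ⟨⟨ζ, d, t⟩, ⟨hζ, h⟩, hmax⟩ := (isCompact_choices E).exists_isMaxOn
    ⟨(0, d₀, t₀), ⟨le_rfl, E.K_nonneg⟩, h₀⟩ hc.continuousOn
  refine ⟨ζ, _, d, erf t, isScheme_of_mem hζ,
    (isResearcherChoice_iff (isScheme_of_mem hζ)).2 ⟨t, rfl, h⟩, fun d' ρ' h' => ?_⟩
  obtain ⟨ζ', hζ', t', rfl, hc'⟩ := implementable_iff.1 h'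
  rw [benefit_eq E.q_pos h.1, benefit_eq E.q_pos hc'.1]
  exact isMaxOn_iff.1 hmax (ζ', d', t') ⟨hζ', hc'⟩

lemma OnFrontier.le_cap {E : Env} {d ρ : ℝ} (h : OnFrontier E d ρ) : d ≤ E.s := by
  obtain ⟨ζ, hζ, t, -, hc⟩ := implementable_iff.1 h.1
  exact hc.dist_le_cap hζ.1

lemma exists_onFrontier {E : Env} {ζ d t : ℝ} (h : IsChoice E ζ d t) (hζ : ζ ∈ Set.Icc 0 E.K) :
    ∃ x, d ≤ x ∧ OnFrontier E x (erf t) := by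
  have hK := (isCompact_choices E).inter_right
    (isClosed_eq (by fun_prop) continuous_const : IsClosed {p : ℝ × ℝ × ℝ | p.2.2 = t})
  obtain ⟨⟨ζ', x, t'⟩, ⟨⟨hζ', hx⟩, rfl⟩, hmax⟩ := hK.exists_isMaxOn
    ⟨(ζ, d, t), ⟨hζ, h⟩, rfl⟩ (f := fun p => p.2.1) (by fun_prop)
  refine ⟨x, isMaxOn_iff.1 hmax (ζ, d, _) ⟨⟨hζ, h⟩, rfl⟩, hx.implementable hζ',
    fun d' hd' => ?_⟩
  obtain ⟨z, hz, t, ht, hc⟩ := implementable_iff.1 hd'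
  have := strictMono_erf.injective ht
  exact isMaxOn_iff.1 hmax (z, d', t) ⟨⟨hz, hc⟩, this⟩

/-! ### Comparative statics along the budget line -/

/-- How the ratio of reach and cost changes along the budget line. -/
lemma Env.reach_mul_cost_sub (E : Env) (a b : ℝ) :
    E.reach b * E.cost a - E.reach a * E.cost b = (b - a) * (E.cost 0 / E.s - 1 / E.κ) := by
  rw [E.cost_eq a, E.cost_eq b, Env.reach, Env.reach]
  ring

lemma IsChoice.inducedRatio_sub {E : Env} {z z' d d' t t' : ℝ} (h : IsChoice E z d t)
    (h' : IsChoice E z' d' t') (hz : 0 ≤ z) (hz' : 0 ≤ z') (hd : d < 4 * E.q)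
    (hd' : d' < 4 * E.q) :
    (inducedRatio t' - inducedRatio t) * (E.cost z * E.cost z') =
      (z' - z) * (E.cost 0 / E.s - 1 / E.κ) := by
  have h1 := (E.cost_pos hz).ne'
  have h2 := (E.cost_pos hz').ne'
  rw [h.inducedRatio_eq hz hd, h'.inducedRatio_eq hz' hd', ← E.reach_mul_cost_sub]
  field_simp

/-- If relative productivity rises along the budget line, rewards raise novelty and output. -/
lemma IsChoice.effort_lt {E : Env} {z z' d d' t t' : ℝ} (h : IsChoice E z d t)
    (h' : IsChoice E z' d' t') (hz : 0 ≤ z) (hzz : z < z') (hd : d < 4 * E.q)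
    (hd' : d' < 4 * E.q) (hE : 1 / E.κ < E.cost 0 / E.s) : t < t' := by
  have hz' := hz.trans hzz.le
  have h1 := h.inducedRatio_sub h' hz hz' hd hd'
  have h2 := mul_pos (E.cost_pos hz) (E.cost_pos hz')
  have h3 := mul_pos (sub_pos.2 hzz) (sub_pos.2 hE)
  rw [← h1] at h3
  exact (inducedRatio_lt_iff (h.effort_pos hz) (h'.effort_pos hz')).1
    (sub_pos.1 (pos_of_mul_pos_left h3 h2.le))

lemma IsChoice.effort_gt {E : Env} {z z' d d' t t' : ℝ} (h : IsChoice E z d t)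
    (h' : IsChoice E z' d' t') (hz : 0 ≤ z) (hzz : z < z') (hd : d < 4 * E.q)
    (hd' : d' < 4 * E.q) (hE : E.cost 0 / E.s < 1 / E.κ) : t' < t := by
  have hz' := hz.trans hzz.le
  have h1 := h.inducedRatio_sub h' hz hz' hd hd'
  have h2 := mul_pos (E.cost_pos hz) (E.cost_pos hz')
  have h3 := mul_pos (sub_pos.2 hzz) (sub_pos.2 hE)
  have h4 : 0 < (inducedRatio t - inducedRatio t') * (E.cost z * E.cost z') := by linarith
  exact (inducedRatio_lt_iff (h'.effort_pos hz') (h.effort_pos hz)).1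
    (sub_pos.1 (pos_of_mul_pos_left h4 h2.le))

lemma IsChoice.effort_eq {E : Env} {z z' d d' t t' : ℝ} (h : IsChoice E z d t)
    (h' : IsChoice E z' d' t') (hz : 0 ≤ z) (hz' : 0 ≤ z') (hd : d < 4 * E.q)
    (hd' : d' < 4 * E.q) (hE : E.cost 0 / E.s = 1 / E.κ) : t' = t := by
  have h1 := h.inducedRatio_sub h' hz hz' hd hd'
  have h2 := mul_pos (E.cost_pos hz) (E.cost_pos hz')
  rw [hE, sub_self, mul_zero] at h1
  exact inducedRatio_inj (h'.effort_pos hz') (h.effort_pos hz)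
    (sub_eq_zero.1 ((mul_eq_zero.1 h1).resolve_right h2.ne'))

lemma IsChoice.dist_lt {E : Env} {z z' d d' t t' : ℝ} (h : IsChoice E z d t)
    (h' : IsChoice E z' d' t') (hz : 0 ≤ z) (hzz : z < z') (hd : d < 4 * E.q)
    (hd' : d' < 4 * E.q) (ht : t ≤ t') : d < d' := by
  have hz' := hz.trans hzz.le
  rw [h.dist_eq hz hd, h'.dist_eq hz' hd', mul_assoc, mul_assoc (6 * E.q)]
  have h1 := E.reach_lt hzz
  have h2 := noveltyShare_le (h.effort_pos hz) ht
  have h3 := third_lt_noveltyShare (h.effort_pos hz)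
  have h4 := E.reach_pos hz
  have := E.q_pos
  refine mul_lt_mul_of_pos_left ?_ (by positivity)
  nlinarith

/-- At a given output, the frontier is at the reward cap or at the only interior choice. -/
lemma OnFrontier.eq_cap_or {E : Env} {z d t x : ℝ} (hx : OnFrontier E x (erf t))
    (h : IsChoice E z d t) (hz : 0 ≤ z) (hd : d < 4 * E.q)
    (hE : E.cost 0 / E.s ≠ 1 / E.κ) : x = E.s ∨ x = d := by
  obtain ⟨z', hz', t', ht', h'⟩ := implementable_iff.1 hx.1
  obtain rfl := strictMono_erf.injective ht'
  rcases h'.lt_or_eq_cap hz'.1 with hx' | hx'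
  · right
    have h1 := h.inducedRatio_sub h' hz hz'.1 hd hx'
    rw [sub_self, zero_mul, eq_comm] at h1
    have h2 := sub_eq_zero.1 ((mul_eq_zero.1 h1).resolve_right (sub_ne_zero.2 hE))
    rw [h'.dist_eq hz'.1 hx', h.dist_eq hz hd, h2]
  · exact Or.inl hx'

/-- Small rewards never induce a distance of `4 q` or more. -/
lemma IsChoice.lt_of_reward_le {E : Env} {ζ d t : ℝ} (h : IsChoice E ζ d t) (hζ : 0 ≤ ζ)
    (hζq : ζ ≤ E.q / 6) : d < 4 * E.q := by
  refine (h.lt_or_eq_cap hζ).resolve_right fun hd => ?_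
  have hq := E.q_pos
  have ht := h.effort_pos hζ
  -- At the cap a success pays at most `4q/3 + q/6 = 3q/2`, which distance `3q` already provides at
  -- lower cost.
  have h1 := h.2.2 (3 * E.q) t (by positivity) ht.le
  have hs : 3 * E.q < d := by linarith [E.s_ge]
  have h2 : successReward E ζ d ≤ 3 * E.q / 2 := by
    rw [successReward_of_ge hd.ge]
    linarith [benefitFormula_le_of_ge hq (hd ▸ E.s_ge)]
  have h3 : 3 * E.q / 2 ≤ successReward E ζ (3 * E.q) := by
    have h4 := E.one_le_reach hζ
    rw [successReward_of_lt (by linarith)]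
    have h5 : 3 * E.q / (6 * E.q) = 1 / 2 := by field_simp; norm_num
    rw [h5]
    nlinarith
  have h4 := mul_pos (E.cost_pos hζ) (pow_pos ht 2)
  have h5 := erf_pos ht
  rw [profit, profit] at h1
  nlinarith [mul_lt_mul_of_pos_left hs h4]

/-- Without rewards novelty lies strictly between `2 q` and `3 q`. -/
lemma IsChoice.dist_mem_of_no_reward {E : Env} {d t : ℝ} (h : IsChoice E 0 d t) :
    2 * E.q < d ∧ d < 3 * E.q := by
  have hq := E.q_pos
  have hd := h.lt_of_reward_le le_rfl (by positivity)
  have ht := h.effort_pos le_rfl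
  have h1 := third_lt_noveltyShare ht
  have h2 := noveltyShare_lt_half ht
  have h3 : E.reach 0 = 1 := by simp [Env.reach]
  rw [h.dist_eq le_rfl hd, h3]
  constructor <;> nlinarith

/-! ### Excessive interior choices survive a small reduction of the reward -/

/-- The researcher's surplus from output, per unit of cost and novelty. -/
noncomputable def outputSurplus (t : ℝ) : ℝ := marginalCost t * (1 - costElasticity t)

lemma erf_mul_outputSurplus {t : ℝ} (ht : 0 < t) :
    erf t * outputSurplus t = erf t * marginalCost t - t ^ 2 := by
  rw [← costElasticity_mul ht, outputSurplus]; ring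

lemma outputSurplus_pos {t : ℝ} (ht : 0 < t) : 0 < outputSurplus t :=
  mul_pos (marginalCost_pos ht) (by linarith [costElasticity_lt_half ht])

lemma outputSurplus_lt {a b : ℝ} (ha : 0 < a) (hab : a < b) :
    outputSurplus a < outputSurplus b := by
  have h1 := marginalCost_lt ha hab
  have h2 := costElasticity_lt ha hab
  have h3 := costElasticity_lt_half ha
  have h4 := marginalCost_pos ha
  unfold outputSurplus
  nlinarith

/-- The effect of a marginal shift of the budget to rewards on the payoff per unit of novelty. -/
noncomputable def rewardGain (E : Env) (t : ℝ) : ℝ := erf t / E.s - t ^ 2 / E.κ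

lemma profit_sub_profit {E : Env} {z ζ d t : ℝ} (hd : d ≤ E.s) :
    profit E ζ d t - profit E z d t = (ζ - z) * (d * rewardGain E t) := by
  rw [profit, profit, successReward_cap hd, successReward_cap hd, E.cost_eq ζ, E.cost_eq z,
    rewardGain]
  ring

/-- Past `3q` the benefit itself falls with distance, so the reward alone must more than cover the
marginal cost of novelty: `cost ζ * t² < erf t * ζ / s`. The cost parameter in turn exceeds `ζ / κ`.
-/
lemma IsChoice.rewardGain_pos {E : Env} {ζ d t : ℝ} (h : IsChoice E ζ d t) (hζ : 0 ≤ ζ)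
    (hd3 : 3 * E.q < d) (hd : d < 4 * E.q) : 0 < rewardGain E t := by
  have hq := E.q_pos
  have ht := h.effort_pos hζ
  have hρ := erf_pos ht
  have h1 := h.effort_sq_eq hζ hd
  have h2 : 1 < d / (3 * E.q) := by rw [one_lt_div (by positivity)]; exact hd3
  have h3 : E.cost ζ * t ^ 2 < erf t * (ζ / E.s) := by
    rw [← h1]
    refine mul_lt_mul_of_pos_left ?_ hρ
    rw [Env.reach]; linarith
  have h4 : ζ / E.κ < E.cost ζ := by
    rw [E.cost_eq ζ]; linarith [E.cost_zero_pos]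
  have h5 : ζ * (t ^ 2 / E.κ) < ζ * (erf t / E.s) := by
    calc ζ * (t ^ 2 / E.κ) = ζ / E.κ * t ^ 2 := by ring
      _ ≤ E.cost ζ * t ^ 2 := by gcongr
      _ < erf t * (ζ / E.s) := h3
      _ = _ := by ring
  exact sub_pos.2 (lt_of_mul_lt_mul_left h5 hζ)

/-- If the researcher is indifferent between an excessive interior distance and the cap, then
shifting the budget to rewards makes the cap more attractive. -/
lemma IsChoice.rewardGain_lt_cap {E : Env} {ζ d t t' : ℝ} (h : IsChoice E ζ d t) (hζ : 0 ≤ ζ)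
    (hd3 : 3 * E.q < d) (hd : d < 4 * E.q) (h' : IsChoice E ζ E.s t') :
    d * rewardGain E t < E.s * rewardGain E t' := by
  by_contra! H
  have ht := h.effort_pos hζ
  have ht' := h'.effort_pos hζ
  have hρ := erf_pos ht
  have hρ' := erf_pos ht'
  have hds : d < E.s := hd.trans_le E.s_ge
  have hd0 := h.dist_pos hζ
  -- Indifference between the two choices, divided by the common cost parameter. As `s > d`, output
  -- at the cap must be lower.
  have hval : E.s * (erf t' * outputSurplus t') = d * (erf t * outputSurplus t) := by
    rw [erf_mul_outputSurplus ht, erf_mul_outputSurplus ht']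
    refine mul_left_cancel₀ (E.cost_pos hζ).ne' ?_
    rw [← h.profit_eq hζ, ← h'.profit_eq hζ]
    exact le_antisymm (h.2.2 _ _ h'.1 h'.2.1) (h'.2.2 _ _ h.1 h.2.1)
  have hs := outputSurplus_pos ht
  have hs' := outputSurplus_pos ht'
  have htt : t' < t := by
    by_contra! hle
    have h1 : erf t ≤ erf t' := strictMono_erf.monotone hle
    have h2 : outputSurplus t ≤ outputSurplus t' := by
      rcases hle.eq_or_lt with rfl | hlt
      · exact le_rfl
      · exact (outputSurplus_lt ht hlt).le
    have h3 : erf t * outputSurplus t ≤ erf t' * outputSurplus t' := by gcongr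
    have h4 := mul_pos hρ hs
    nlinarith
  have hG := h.rewardGain_pos hζ hd3 hd
  -- Per unit of output the gain falls with effort, so it is at least as large at the cap. The
  -- negated claim then gives `s * erf t' ≤ d * erf t`, and the strictly smaller surplus at `t'`
  -- contradicts `hval`.
  have hquot : ∀ τ, 0 < τ → rewardGain E τ = erf τ * (1 / E.s - τ / erf τ * τ / E.κ) := by
    intro τ hτ
    have := (erf_pos hτ).ne'
    rw [rewardGain]
    field_simp
  have hκ := E.κ_pos
  have h5 : 1 / E.s - t / erf t * t / E.κ ≤ 1 / E.s - t' / erf t' * t' / E.κ := by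
    have := (div_erf_lt ht' htt).le
    gcongr
  rw [hquot t ht] at hG H
  rw [hquot t' ht'] at H
  have hθ := pos_of_mul_pos_right hG hρ.le
  set θ := 1 / E.s - t / erf t * t / E.κ
  set θ' := 1 / E.s - t' / erf t' * t' / E.κ
  have h6 : E.s * erf t' ≤ d * erf t := by
    refine le_of_mul_le_mul_right ?_ hθ
    have := mul_le_mul_of_nonneg_left h5 (mul_pos E.s_pos hρ').le
    linarith
  have h7 := outputSurplus_lt ht' htt
  have h8 := mul_le_mul_of_nonneg_right h6 hs'.le
  have h9 := mul_lt_mul_of_pos_left h7 (mul_pos hd0 hρ)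
  linarith

/-- An excessive interior choice remains interior when the reward is slightly reduced. -/
lemma IsChoice.eventually_interior {E : Env} {ζ d t : ℝ} (h : IsChoice E ζ d t)
    (hζ : ζ ∈ Set.Icc 0 E.K) (hd3 : 3 * E.q < d) (hd : d < 4 * E.q) :
    ∀ᶠ z in nhdsWithin ζ (Set.Iio ζ), ∀ d' t', 0 ≤ z → IsChoice E z d' t' → d' < 4 * E.q := by
  have hcont : Continuous (rewardGain E) := by
    have := continuous_erf
    unfold rewardGain; fun_prop
  -- Rewards admitting a cap choice whose gain does not exceed that of `(d, t)` form a compact set,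
  -- which misses `ζ` and hence a neighbourhood of it.
  have hcl : IsClosed {p : ℝ × ℝ × ℝ | p.2.1 = E.s ∧
      E.s * rewardGain E p.2.2 ≤ d * rewardGain E t} :=
    (isClosed_eq (by fun_prop) continuous_const : IsClosed {p : ℝ × ℝ × ℝ | p.2.1 = E.s}).inter
      (isClosed_le (hcont.comp (continuous_snd.comp continuous_snd) |> continuous_const.mul)
        continuous_const)
  have hS := (((isCompact_choices E).inter_right hcl).image continuous_fst).isClosed
  have hnot : ζ ∉ Prod.fst '' ({p : ℝ × ℝ × ℝ | p.1 ∈ Set.Icc 0 E.K ∧ IsChoice E p.1 p.2.1 p.2.2} ∩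
      {p : ℝ × ℝ × ℝ | p.2.1 = E.s ∧ E.s * rewardGain E p.2.2 ≤ d * rewardGain E t}) := by
    rintro ⟨⟨z, x, τ⟩, ⟨⟨-, hc⟩, hx, hle⟩, rfl⟩
    simp only at hx hle hc h hζ
    subst hx
    exact absurd hle (not_le.2 (h.rewardGain_lt_cap hζ.1 hd3 hd hc))
  filter_upwards [nhdsWithin_le_nhds (hS.isOpen_compl.mem_nhds hnot), self_mem_nhdsWithin]
    with z hz hzζ d' t' hz0 h'
  refine (h'.lt_or_eq_cap hz0).resolve_right ?_
  rintro rfl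
  refine hz ⟨(z, E.s, t'), ⟨⟨⟨hz0, (le_of_lt hzζ).trans hζ.2⟩, h'⟩, rfl, ?_⟩, rfl⟩
  -- Revealed preference: `(d, t)` is best at `ζ` and the cap choice at `z < ζ`, so the cap choice
  -- cannot have the larger gain and lies in the excluded set.
  have h1 := profit_sub_profit (E := E) (z := z) (ζ := ζ) (t := t) (h.dist_le_cap hζ.1)
  have h2 := profit_sub_profit (E := E) (z := z) (ζ := ζ) (t := t') (le_refl E.s)
  have h3 := h.2.2 _ _ h'.1 h'.2.1
  have h4 := h'.2.2 _ _ h.1 h.2.1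
  exact le_of_mul_le_mul_left (by linarith) (sub_pos.2 hzζ)

/-- A continuous path of interior choices below an excessive interior choice. -/
lemma IsChoice.exists_path {E : Env} {ζ d t : ℝ} (h : IsChoice E ζ d t)
    (hζ : ζ ∈ Set.Icc 0 E.K) (hd3 : 3 * E.q < d) (hd : d < 4 * E.q) :
    ∃ D τ : ℝ → ℝ, (∀ᶠ z in nhdsWithin ζ (Set.Iio ζ), (0 ≤ z ∧ z < ζ) ∧
      IsChoice E z (D z) (τ z) ∧ D z < 4 * E.q) ∧
      Filter.Tendsto D (nhdsWithin ζ (Set.Iio ζ)) (nhds d) := by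
  have hζ0 : 0 < ζ := by
    refine lt_of_le_of_ne hζ.1 ?_
    rintro rfl
    linarith [h.dist_mem_of_no_reward.2]
  have hex : ∀ z, ∃ p : ℝ × ℝ, 0 ≤ z → IsChoice E z p.1 p.2 := fun z => by
    by_cases hz : 0 ≤ z
    · obtain ⟨x, y, hxy⟩ := exists_isChoice E hz
      exact ⟨(x, y), fun _ => hxy⟩
    · exact ⟨0, fun h => absurd h hz⟩
  choose p hp using hex
  have hev : ∀ᶠ z in nhdsWithin ζ (Set.Iio ζ), (0 ≤ z ∧ z < ζ) ∧
      IsChoice E z (p z).1 (p z).2 ∧ (p z).1 < 4 * E.q := by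
    filter_upwards [h.eventually_interior hζ hd3 hd, self_mem_nhdsWithin,
      nhdsWithin_le_nhds (lt_mem_nhds hζ0)] with z hz hzζ hz0
    exact ⟨⟨le_of_lt hz0, hzζ⟩, hp z (le_of_lt hz0), hz _ _ (le_of_lt hz0) (hp z (le_of_lt hz0))⟩
  refine ⟨fun z => (p z).1, fun z => (p z).2, hev, ?_⟩
  have hreach : Continuous E.reach := by unfold Env.reach; fun_prop
  have hcost : Continuous E.cost := by unfold Env.cost; fun_prop
  have ht := h.effort_pos hζ.1
  have hR : Filter.Tendsto (fun z => inducedRatio (p z).2) (nhdsWithin ζ (Set.Iio ζ))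
      (nhds (inducedRatio t)) := by
    rw [h.inducedRatio_eq hζ.1 hd]
    have := ((hreach.continuousAt (x := ζ)).div hcost.continuousAt
      (E.cost_pos hζ.1).ne').tendsto.mono_left (nhdsWithin_le_nhds (s := Set.Iio ζ))
    refine this.congr' ?_
    filter_upwards [hev] with z hz
    exact (hz.2.1.inducedRatio_eq hz.1.1 hz.2.2).symm
  -- Convergence of the induced ratios passes to the efforts by strict monotonicity; no continuity
  -- of an inverse is needed.
  have hτ : Filter.Tendsto (fun z => (p z).2) (nhdsWithin ζ (Set.Iio ζ)) (nhds t) := by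
    refine tendsto_order.2 ⟨fun a ha => ?_, fun b hb => ?_⟩
    · rcases le_or_gt a 0 with ha0 | ha0
      · filter_upwards [hev] with z hz
        exact ha0.trans_lt (hz.2.1.effort_pos hz.1.1)
      · filter_upwards [hev, hR.eventually (lt_mem_nhds (inducedRatio_lt ha0 ha))] with z hz hz'
        exact (inducedRatio_lt_iff ha0 (hz.2.1.effort_pos hz.1.1)).1 hz'
    · filter_upwards [hev, hR.eventually (gt_mem_nhds (inducedRatio_lt ht hb))] with z hz hz'
      exact (inducedRatio_lt_iff (hz.2.1.effort_pos hz.1.1) (ht.trans hb)).1 hz'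
  have hD : Filter.Tendsto (fun z => 6 * E.q * E.reach z * noveltyShare (p z).2)
      (nhdsWithin ζ (Set.Iio ζ)) (nhds d) := by
    rw [h.dist_eq hζ.1 hd]
    exact ((hreach.continuousAt (x := ζ)).tendsto.mono_left nhdsWithin_le_nhds).const_mul _ |>.mul
      ((continuousAt_noveltyShare ht).tendsto.comp hτ)
  refine hD.congr' ?_
  filter_upwards [hev] with z hz
  exact (hz.2.1.dist_eq hz.1.1 hz.2.2).symm

/-! ### No excessive novelty when output decreases in novelty -/

lemma benefitFormula_lt_of_excessive {q x y : ℝ} (hq : 0 < q) (hx : 3 * q ≤ x) (hxy : x < y)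
    (hy : y ≤ 4 * q) : benefitFormula q y < benefitFormula q x := by
  rw [benefitFormula_of_le hq hy, benefitFormula_of_le hq (hxy.le.trans hy)]
  have : x - x ^ 2 / (6 * q) - (y - y ^ 2 / (6 * q)) = (y - x) * (x + y - 6 * q) / (6 * q) := by
    field_simp; ring
  have h2 : 0 < (y - x) * (x + y - 6 * q) / (6 * q) :=
    div_pos (mul_pos (by linarith) (by linarith)) (by positivity)
  linarith

/-- If output decreases in novelty throughout, novelty `s` is not optimal. -/
lemma not_optimal_cap {E : Env} (H : OutputDecreases E) {ζ t : ℝ} (hζ : ζ ∈ Set.Icc 0 E.K)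
    (h : IsChoice E ζ E.s t)
    (hopt : ∀ ζ' ∈ Set.Icc 0 E.K, ∀ d' t', IsChoice E ζ' d' t' →
      funderPayoff E d' t' ≤ funderPayoff E E.s t) : False := by
  have hq := E.q_pos
  have h0m : (0 : ℝ) ∈ Set.Icc 0 E.K := ⟨le_rfl, E.K_nonneg⟩
  obtain ⟨d₀, t₀, h₀⟩ := exists_isChoice E le_rfl
  obtain ⟨hd₀, hd₀'⟩ := h₀.dist_mem_of_no_reward
  have h1 := hopt 0 h0m _ _ h₀
  -- The benefit equals `4q/3` at both `2q` and `4q` and is larger in between.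
  have hV : 4 * E.q / 3 < benefitFormula E.q d₀ := by
    rw [benefitFormula_of_le hq (by linarith)]
    have e : d₀ - d₀ ^ 2 / (6 * E.q) - 4 * E.q / 3 =
        (d₀ - 2 * E.q) * (4 * E.q - d₀) / (6 * E.q) := by field_simp; ring
    have : 0 < (d₀ - 2 * E.q) * (4 * E.q - d₀) / (6 * E.q) :=
      div_pos (mul_pos (by linarith) (by linarith)) (by positivity)
    linarith
  have hVs := benefitFormula_le_of_ge hq E.s_ge
  have hρ₀ := erf_pos (h₀.effort_pos le_rfl)
  have hlt : erf t₀ < erf t := by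
    unfold funderPayoff at h1
    have h2 := benefitFormula_pos hq E.s_pos
    by_contra! hle
    nlinarith [mul_lt_mul_of_pos_left (hVs.trans_lt hV) hρ₀, mul_le_mul_of_nonneg_right hle h2.le]
  have hds : d₀ < E.s := by linarith [E.s_ge]
  rcases H with H | H
  · obtain ⟨x, hx, hxF⟩ := exists_onFrontier h hζ
    obtain ⟨x₀, hx₀, hxF₀⟩ := exists_onFrontier h₀ h0m
    have := H _ _ _ _ hxF₀ hxF hlt
    linarith [hxF₀.le_cap]
  · exact lt_asymm hlt (H _ _ _ _ (h₀.implementable h0m) (h.implementable hζ) hds)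

/-- If output decreases in novelty throughout, an excessive interior distance is not optimal. -/
lemma not_optimal_interior {E : Env} (H : OutputDecreases E) {ζ d t : ℝ}
    (hζ : ζ ∈ Set.Icc 0 E.K) (h : IsChoice E ζ d t) (hd3 : 3 * E.q < d) (hd : d < 4 * E.q)
    (hopt : ∀ ζ' ∈ Set.Icc 0 E.K, ∀ d' t', IsChoice E ζ' d' t' →
      funderPayoff E d' t' ≤ funderPayoff E d t) : False := by
  have hq := E.q_pos
  have ht := h.effort_pos hζ.1
  have hVd := benefitFormula_pos hq (h.dist_pos hζ.1)
  have hmem : ∀ z, 0 ≤ z → z < ζ → z ∈ Set.Icc 0 E.K := fun z h0 h1 => ⟨h0, h1.le.trans hζ.2⟩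
  obtain ⟨D, τ, hev, hD⟩ := h.exists_path hζ hd3 hd
  rcases lt_trichotomy (E.cost 0 / E.s) (1 / E.κ) with hE | hE | hE
  -- Here a lower reward raises output. Were novelty not to rise as well, the funder would gain,
  -- since the benefit decreases beyond `3q`.
  · have hev' : ∀ᶠ z in nhdsWithin ζ (Set.Iio ζ), d < D z := by
      filter_upwards [hev, hD.eventually (lt_mem_nhds hd3)] with z hz hz3
      by_contra! hle
      have h1 := hopt z (hmem z hz.1.1 hz.1.2) _ _ hz.2.1
      have h2 := strictMono_erf (hz.2.1.effort_gt h hz.1.1 hz.1.2 hz.2.2 hd hE)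
      have h3 : benefitFormula E.q d ≤ benefitFormula E.q (D z) := by
        rcases hle.eq_or_lt with e | hlt
        · rw [e]
        · exact (benefitFormula_lt_of_excessive hq hz3.le hlt hd.le).le
      unfold funderPayoff at h1
      nlinarith [erf_pos ht]
    rcases H with H | H
    -- For `z` between `z'` and `ζ`, output lies between those at `z'` and `ζ`. A decreasing
    -- frontier is then below the cap at `τ z`, hence equals `D z`, and exceeds `D z' > d`. This
    -- contradicts `D z → d`.
    · obtain ⟨z', hz', hdz'⟩ := (hev.and hev').exists
      have hm' := hmem z' hz'.1.1 hz'.1.2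
      obtain ⟨x', hx', hxF'⟩ := exists_onFrontier hz'.2.1 hm'
      obtain ⟨x, hx, hxF⟩ := exists_onFrontier h hζ
      have h1 : ∀ᶠ z in nhdsWithin ζ (Set.Iio ζ), D z' ≤ D z := by
        filter_upwards [hev, nhdsWithin_le_nhds (lt_mem_nhds hz'.1.2)] with z hz hzz'
        have hm := hmem z hz.1.1 hz.1.2
        obtain ⟨y, hy, hyF⟩ := exists_onFrontier hz.2.1 hm
        have h2 := H _ _ _ _ hxF hyF
          (strictMono_erf (hz.2.1.effort_gt h hz.1.1 hz.1.2 hz.2.2 hd hE))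
        have h3 := H _ _ _ _ hyF hxF'
          (strictMono_erf (hz'.2.1.effort_gt hz.2.1 hz'.1.1 hzz' hz'.2.2 hz.2.2 hE))
        rcases hyF.eq_cap_or hz.2.1 hz.1.1 hz.2.2 hE.ne with e | e
        · linarith [hxF.le_cap]
        · linarith
      linarith [ge_of_tendsto hD h1]
    · obtain ⟨z, hz, hdz⟩ := (hev.and hev').exists
      have h2 := strictMono_erf (hz.2.1.effort_gt h hz.1.1 hz.1.2 hz.2.2 hd hE)
      exact lt_asymm h2 (H _ _ _ _ (h.implementable hζ)
        (hz.2.1.implementable (hmem z hz.1.1 hz.1.2)) hdz)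
  · obtain ⟨z, hz, hz3⟩ := (hev.and (hD.eventually (lt_mem_nhds hd3))).exists
    have h1 := hopt z (hmem z hz.1.1 hz.1.2) _ _ hz.2.1
    have h2 : t = τ z := hz.2.1.effort_eq h hz.1.1 hζ.1 hz.2.2 hd hE
    have h3 := hz.2.1.dist_lt h hz.1.1 hz.1.2 hz.2.2 hd h2.ge
    rw [← h2] at h1
    exact absurd h1 (not_le.2 (mul_lt_mul_of_pos_left
      (benefitFormula_lt_of_excessive hq hz3.le h3 hd.le) (erf_pos ht)))
  · rcases H with H | H
    -- Here novelty and output both rise with the reward. The third reward `z < z'` only serves to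
    -- show that the frontier at `τ z'` is below the cap, so that it equals `D z'`.
    · obtain ⟨z, hz⟩ := hev.exists
      obtain ⟨z', hz', hzz'⟩ := (hev.and (nhdsWithin_le_nhds (lt_mem_nhds hz.1.2))).exists
      have hτ := hz'.2.1.effort_lt h hz'.1.1 hz'.1.2 hz'.2.2 hd hE
      obtain ⟨x, hx, hxF⟩ := exists_onFrontier h hζ
      obtain ⟨y, hy, hyF⟩ := exists_onFrontier hz.2.1 (hmem z hz.1.1 hz.1.2)
      obtain ⟨y', hy', hyF'⟩ := exists_onFrontier hz'.2.1 (hmem z' hz'.1.1 hz'.1.2)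
      have h1 := H _ _ _ _ hyF' hxF (strictMono_erf hτ)
      have h2 := H _ _ _ _ hyF hyF' (strictMono_erf
        (hz.2.1.effort_lt hz'.2.1 hz.1.1 hzz' hz.2.2 hz'.2.2 hE))
      rcases hyF'.eq_cap_or hz'.2.1 hz'.1.1 hz'.2.2 hE.ne' with e | e
      · linarith [hyF.le_cap]
      · linarith [hz'.2.1.dist_lt h hz'.1.1 hz'.1.2 hz'.2.2 hd hτ.le]
    · obtain ⟨z, hz⟩ := hev.exists
      have hτ := hz.2.1.effort_lt h hz.1.1 hz.1.2 hz.2.2 hd hE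
      exact lt_asymm (strictMono_erf hτ) (H _ _ _ _
        (hz.2.1.implementable (hmem z hz.1.1 hz.1.2)) (h.implementable hζ)
        (hz.2.1.dist_lt h hz.1.1 hz.1.2 hz.2.2 hd hτ.le))

/-- If output decreases in novelty throughout, optimal funding never induces excessive novelty. -/
theorem OutputDecreases.optimal_dist_le {E : Env} (H : OutputDecreases E) {ζ h d ρ : ℝ}
    (hopt : IsOptimalFunding E ζ h d ρ) : d ≤ 3 * E.q := by
  obtain ⟨hζ, t, -, hc, hmax⟩ := hopt.exists_isChoice
  by_contra! hd3
  rcases hc.lt_or_eq_cap hζ.1 with hd | rfl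
  · exact not_optimal_interior H hζ hc hd3 hd hmax
  · exact not_optimal_cap H hζ hc hmax

/-! ### Rational enclosures of `exp`, `erf` and the derived functions -/

section Bounds

lemma sqrt_pi_bounds : 1.7724 < √π ∧ √π < 1.7725 := by
  constructor
  · rw [lt_sqrt (by norm_num)]
    linarith [pi_gt_d4]
  · rw [sqrt_lt' (by norm_num)]
    linarith [pi_lt_d4]

lemma exp_lower {x : ℝ} (hx : 0 ≤ x) : 1 + x + x ^ 2 / 2 + x ^ 3 / 6 ≤ exp x := by
  have := sum_le_exp_of_nonneg hx 4
  simp only [Finset.sum_range_succ, Finset.sum_range_zero, Nat.factorial] at this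
  norm_num at this
  linarith

lemma exp_upper {x : ℝ} (hx : 0 ≤ x) (hx1 : x ≤ 1) :
    exp x ≤ 1 + x + x ^ 2 / 2 + x ^ 3 / 6 + x ^ 4 * 5 / 96 := by
  have := exp_bound' hx hx1 (n := 4) (by norm_num)
  simp only [Finset.sum_range_succ, Finset.sum_range_zero, Nat.factorial] at this
  norm_num at this
  linarith

lemma exp_neg_lt {x : ℝ} (hx : 0 < x) : exp (-x) < 1 - x + x ^ 2 / 2 := by
  have := pos_of_hasDerivAt_pos (f := fun x => 1 - x + x ^ 2 / 2 - exp (-x))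
    (f' := fun x => -1 + x + exp (-x))
    (fun x => ((((hasDerivAt_id x).const_sub 1).add ((hasDerivAt_pow 2 x).div_const 2)).sub
      (hasDerivAt_neg x).exp).congr_deriv (by push_cast; ring))
    (fun x hx => by linarith [add_one_lt_exp (neg_ne_zero.2 hx.ne')]) (by simp) hx
  linarith

lemma lt_exp_neg {x : ℝ} (hx : 0 < x) : 1 - x + x ^ 2 / 2 - x ^ 3 / 6 < exp (-x) := by
  have := pos_of_hasDerivAt_pos (f := fun x => exp (-x) - (1 - x + x ^ 2 / 2 - x ^ 3 / 6))
    (f' := fun x => 1 - x + x ^ 2 / 2 - exp (-x))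
    (fun x => ((hasDerivAt_neg x).exp.sub ((((hasDerivAt_id x).const_sub 1).add
      ((hasDerivAt_pow 2 x).div_const 2)).sub ((hasDerivAt_pow 3 x).div_const 6))).congr_deriv
        (by push_cast; ring))
    (fun x hx => by linarith [exp_neg_lt hx]) (by simp) hx
  linarith

lemma hasDerivAt_sqrt_pi_mul_erf (t : ℝ) :
    HasDerivAt (fun t => √π * erf t) (2 * exp (-t ^ 2)) t := by
  have hp : √π ≠ 0 := by positivity
  exact ((hasDerivAt_erf t).const_mul _).congr_deriv (by field_simp)

lemma sqrt_pi_mul_erf_upper {t : ℝ} (ht : 0 < t) :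
    √π * erf t < 2 * (t - t ^ 3 / 3 + t ^ 5 / 10) := by
  have := pos_of_hasDerivAt_pos (f := fun t => 2 * (t - t ^ 3 / 3 + t ^ 5 / 10) - √π * erf t)
    (f' := fun t => 2 * (1 - t ^ 2 + (t ^ 2) ^ 2 / 2 - exp (-t ^ 2)))
    (fun t => (((((hasDerivAt_id t).sub ((hasDerivAt_pow 3 t).div_const 3)).add
      ((hasDerivAt_pow 5 t).div_const 10)).const_mul 2).sub
      (hasDerivAt_sqrt_pi_mul_erf t)).congr_deriv (by push_cast; ring))
    (fun t ht => by linarith [exp_neg_lt (pow_pos ht 2)]) (by simp [erf_zero]) ht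
  linarith

lemma sqrt_pi_mul_erf_lower {t : ℝ} (ht : 0 < t) :
    2 * (t - t ^ 3 / 3 + t ^ 5 / 10 - t ^ 7 / 42) < √π * erf t := by
  have := pos_of_hasDerivAt_pos
    (f := fun t => √π * erf t - 2 * (t - t ^ 3 / 3 + t ^ 5 / 10 - t ^ 7 / 42))
    (f' := fun t => 2 * (exp (-t ^ 2) - (1 - t ^ 2 + (t ^ 2) ^ 2 / 2 - (t ^ 2) ^ 3 / 6)))
    (fun t => ((hasDerivAt_sqrt_pi_mul_erf t).sub
      (((((hasDerivAt_id t).sub ((hasDerivAt_pow 3 t).div_const 3)).add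
      ((hasDerivAt_pow 5 t).div_const 10)).sub
      ((hasDerivAt_pow 7 t).div_const 42)).const_mul 2)).congr_deriv (by push_cast; ring))
    (fun t ht => by linarith [lt_exp_neg (pow_pos ht 2)]) (by simp [erf_zero]) ht
  linarith

lemma erf_upper {t : ℝ} (ht : 0 < t) {b : ℝ}
    (hb : 2 * (t - t ^ 3 / 3 + t ^ 5 / 10) ≤ 1.7724 * b) : erf t < b := by
  have h1 := sqrt_pi_mul_erf_upper ht
  have h2 := erf_pos ht
  have h3 := sqrt_pi_bounds.1
  nlinarith

lemma erf_lower {t : ℝ} (ht : 0 < t) {b : ℝ}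
    (hb : 1.7725 * b ≤ 2 * (t - t ^ 3 / 3 + t ^ 5 / 10 - t ^ 7 / 42)) : b < erf t := by
  have h1 := sqrt_pi_mul_erf_lower ht
  have h2 := erf_pos ht
  have h3 := sqrt_pi_bounds.2
  nlinarith

lemma costElasticity_eq (t : ℝ) :
    costElasticity t = t / (exp (t ^ 2) * (√π * erf t)) := by
  rw [costElasticity, exp_neg]
  field_simp

/-- With `e` a rational bound for `exp (t²)` and a Taylor polynomial bounding `√π * erf t`, the
claim becomes rational arithmetic; `√π` itself cancels. -/
lemma costElasticity_upper {t b e : ℝ} (ht : 0 < t) (hb : 0 ≤ b) (he : e ≤ exp (t ^ 2))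
    (h : t ≤ b * (e * (2 * (t - t ^ 3 / 3 + t ^ 5 / 10 - t ^ 7 / 42)))) (he0 : 0 ≤ e) :
    costElasticity t ≤ b := by
  have h1 := sqrt_pi_mul_erf_lower ht
  have h2 := erf_pos ht
  rw [costElasticity_eq, div_le_iff₀ (by positivity)]
  refine h.trans (mul_le_mul_of_nonneg_left ?_ hb)
  refine (mul_le_mul_of_nonneg_left h1.le he0).trans ?_
  exact mul_le_mul_of_nonneg_right he (by positivity)

lemma costElasticity_lower {t b e : ℝ} (ht : 0 < t) (hb : 0 ≤ b) (he : exp (t ^ 2) ≤ e)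
    (h : b * (e * (2 * (t - t ^ 3 / 3 + t ^ 5 / 10))) ≤ t) : b ≤ costElasticity t := by
  have h1 := sqrt_pi_mul_erf_upper ht
  have h2 := erf_pos ht
  rw [costElasticity_eq, le_div_iff₀ (by positivity)]
  refine le_trans (mul_le_mul_of_nonneg_left ?_ hb) h
  refine (mul_le_mul_of_nonneg_left h1.le (exp_pos _).le).trans ?_
  refine mul_le_mul_of_nonneg_right he ?_
  exact le_trans (by positivity) h1.le

lemma marginalCost_lower {t e : ℝ} (ht : 0 ≤ t) (he : e ≤ exp (t ^ 2)) :
    1.7724 * t * e ≤ marginalCost t := by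
  have h3 := sqrt_pi_bounds.1
  have := exp_pos (t ^ 2)
  unfold marginalCost
  calc 1.7724 * t * e ≤ 1.7724 * t * exp (t ^ 2) := by gcongr
    _ ≤ _ := by gcongr

lemma marginalCost_upper {t e : ℝ} (ht : 0 ≤ t) (he : exp (t ^ 2) ≤ e) :
    marginalCost t ≤ 1.7725 * t * e := by
  have h3 := sqrt_pi_bounds.2
  have := exp_pos (t ^ 2)
  unfold marginalCost
  gcongr

lemma erf_mul_marginalCost_upper {t e : ℝ} (ht : 0 < t) (he : exp (t ^ 2) ≤ e) :
    erf t * marginalCost t ≤ t * e * (2 * (t - t ^ 3 / 3 + t ^ 5 / 10)) := by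
  have h1 := sqrt_pi_mul_erf_upper ht
  have h2 := erf_pos ht
  have h3 : erf t * marginalCost t = t * exp (t ^ 2) * (√π * erf t) := by
    unfold marginalCost; ring
  rw [h3]
  have := exp_pos (t ^ 2)
  have he0 := this.le.trans he
  gcongr

lemma noveltyShare_lower {t b : ℝ} (ht : 0 < t) (h : costElasticity t * (1 - b) ≤ 1 - 2 * b) :
    b ≤ noveltyShare t := by
  have := costElasticity_lt_half ht
  rw [noveltyShare, le_div_iff₀ (by linarith)]
  linarith

lemma noveltyShare_upper {t b : ℝ} (ht : 0 < t) (h : 1 - 2 * b ≤ costElasticity t * (1 - b)) :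
    noveltyShare t ≤ b := by
  have := costElasticity_lt_half ht
  rw [noveltyShare, div_le_iff₀ (by linarith)]
  linarith

lemma mul_le_inducedRatio {t : ℝ} (ht : 0 < t) : 2.65 * t ≤ inducedRatio t := by
  have h1 := marginalCost_lower ht.le (e := 1) (one_le_exp (sq_nonneg t))
  have h2 := costElasticity_lt_half ht
  unfold inducedRatio
  nlinarith

/-- A choice with induced ratio close to one has moderate output. -/
lemma costElasticity_lower_of_ratio {t : ℝ} (ht : 0 < t) (h : inducedRatio t ≤ 25 / 24) :
    t < 2 / 5 ∧ 21 / 50 ≤ costElasticity t := by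
  have h1 := mul_le_inducedRatio ht
  have h2 : t < 2 / 5 := by linarith
  refine ⟨h2, le_trans ?_ (exp_half_le_costElasticity ht)⟩
  have h3 := add_one_le_exp (-t ^ 2)
  nlinarith

end Bounds

/-! ### Environments in which a single instrument is optimal -/

lemma benefitFormula_lt_of_le {q x y : ℝ} (hq : 0 < q) (hxy : x < y) (hy : y ≤ 3 * q) :
    benefitFormula q x < benefitFormula q y := by
  rw [benefitFormula_of_le hq (by linarith), benefitFormula_of_le hq (by linarith)]
  have : y - y ^ 2 / (6 * q) - (x - x ^ 2 / (6 * q)) = (y - x) * (6 * q - x - y) / (6 * q) := by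
    field_simp; ring
  have h2 : 0 < (y - x) * (6 * q - x - y) / (6 * q) :=
    div_pos (mul_pos (by linarith) (by linarith)) (by positivity)
  linarith

/-- A parameter constellation in which cost reductions are expensive. -/
noncomputable def rewardEnv : Env where
  q := 1
  s := 4
  K := 1 / 6
  κ := 100
  η₀ := 1
  q_pos := by norm_num
  s_ge := by norm_num
  K_nonneg := by norm_num
  η₀_pos := by norm_num
  κ_gt := by norm_num

/-- Funding can optimally focus on rewards. -/
theorem optimalFunding_rewardEnv : OptimalFundingHas rewardEnv fun ζ h _ => 0 < ζ ∧ h = 0 := by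
  refine ⟨exists_isOptimalFunding _, fun ζ h d ρ H => ?_⟩
  obtain ⟨hζ, t, -, hc, hopt⟩ := H.exists_isChoice
  have hK : rewardEnv.K = 1 / 6 := rfl
  have hq : rewardEnv.q = 1 := rfl
  have hs : rewardEnv.s = 4 := rfl
  have hκ : rewardEnv.κ = 100 := rfl
  have hη : rewardEnv.η₀ = 1 := rfl
  have hKm : (1 / 6 : ℝ) ∈ Set.Icc 0 rewardEnv.K := ⟨by norm_num, hK.ge⟩
  suffices hz : ζ = 1 / 6 by
    refine ⟨by rw [hz]; norm_num, ?_⟩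
    have := H.1.2.2
    rw [hK, hκ] at this
    linarith
  refine le_antisymm (hK ▸ hζ.2) (not_lt.1 fun hlt => ?_)
  obtain ⟨d', t', hc'⟩ := exists_isChoice rewardEnv hKm.1
  have hd := hc.lt_of_reward_le hζ.1 (by rw [hq]; linarith)
  have hd' := hc'.lt_of_reward_le hKm.1 (by rw [hq])
  have ht' := hc'.effort_pos hKm.1
  have hE : 1 / rewardEnv.κ < rewardEnv.cost 0 / rewardEnv.s := by
    rw [Env.cost, hK, hs, hκ, hη]; norm_num
  have htt := hc.effort_lt hc' hζ.1 hlt hd hd' hE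
  have hdd := hc.dist_lt hc' hζ.1 hlt hd hd' htt.le
  have hA : rewardEnv.reach (1 / 6) = 25 / 24 := by rw [Env.reach, hs]; norm_num
  have hR := hc'.inducedRatio_eq hKm.1 hd'
  have hcost : rewardEnv.cost (1 / 6) = 1 := by rw [Env.cost, hK, hκ, hη]; norm_num
  rw [hA, hcost, div_one] at hR
  have hg := (costElasticity_lower_of_ratio ht' hR.le).2
  -- This threshold makes `6 * (25/24) * (12/25) = 3`: even the full reward keeps novelty in the
  -- range where the benefit increases.
  have hu : noveltyShare t' ≤ 12 / 25 := noveltyShare_upper ht' (by linarith)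
  have hd3 : d' ≤ 3 * rewardEnv.q := by
    rw [hc'.dist_eq hKm.1 hd', hA, hq]; linarith
  have h1 := hopt _ hKm _ _ hc'
  have h2 := benefitFormula_lt_of_le rewardEnv.q_pos hdd hd3
  have h3 := strictMono_erf htt
  have h4 := erf_pos (hc.effort_pos hζ.1)
  have h5 := benefitFormula_pos rewardEnv.q_pos (hc.dist_pos hζ.1)
  unfold funderPayoff at h1
  exact absurd h1 (not_le.2 (mul_lt_mul'' h3 h2 h4.le h5.le))

/-- A parameter constellation in which rewards are rarely paid. -/
noncomputable def costReductionEnv : Env where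
  q := 1
  s := 100
  K := 1 / 6
  κ := 1
  η₀ := 7 / 6
  q_pos := by norm_num
  s_ge := by norm_num
  K_nonneg := by norm_num
  η₀_pos := by norm_num
  κ_gt := by norm_num

/-- The induced ratio grows at most slightly faster than linearly at moderate output. -/
lemma inducedRatio_le_of_effort_le {a b x : ℝ} (hb : 0 < b) (hab : b < a)
    (ha : a < 2 / 5) (hx : 0 < x) (hx1 : x ≤ 1) (h : a ^ 2 ≤ (1 + x) * b ^ 2) :
    inducedRatio a ≤ (1 + x) ^ 3 * inducedRatio b := by
  have ha0 := hb.trans hab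
  have hab2 : a ≤ (1 + x) * b := by
    have : a ^ 2 ≤ ((1 + x) * b) ^ 2 := by nlinarith [sq_nonneg b]
    exact (sq_le_sq₀ ha0.le (by positivity)).1 this
  have hg := costElasticity_lt_half hb
  have hg0 := costElasticity_pos hb
  have hδ : a ^ 2 - b ^ 2 ≤ x / 4 := by nlinarith
  have hδ0 : 0 < a ^ 2 - b ^ 2 := by nlinarith
  have he : exp (a ^ 2) ≤ (1 + x) * exp (b ^ 2) := by
    have h1 := exp_upper hδ0.le (by linarith)
    have h2 : exp (a ^ 2) = exp (a ^ 2 - b ^ 2) * exp (b ^ 2) := by rw [← exp_add]; ring_nf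
    rw [h2]
    refine mul_le_mul_of_nonneg_right (h1.trans ?_) (exp_pos _).le
    set δ := a ^ 2 - b ^ 2
    have h3 : δ ≤ 1 := by linarith
    have h4 : δ ^ 2 ≤ δ := by nlinarith
    have h5 : δ ^ 3 ≤ δ := by nlinarith
    have h6 : δ ^ 4 ≤ δ := by nlinarith
    linarith
  have hge : costElasticity b * (1 - x) ≤ costElasticity a := by
    have h1 := (div_erf_lt hb hab).le
    have h2 : ∀ t, costElasticity t = t / erf t * exp (-t ^ 2) / √π := fun t => by
      rw [costElasticity]; field_simp
    have h3 : exp (-b ^ 2) * (1 - x) ≤ exp (-a ^ 2) := by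
      have h4 : exp (-a ^ 2) = exp (-b ^ 2) * exp (-(a ^ 2 - b ^ 2)) := by
        rw [← exp_add]; ring_nf
      rw [h4]
      refine mul_le_mul_of_nonneg_left ?_ (exp_pos _).le
      linarith [add_one_le_exp (-(a ^ 2 - b ^ 2))]
    have h5 : 0 < b / erf b := div_pos hb (erf_pos hb)
    rw [h2, h2, div_mul_eq_mul_div]
    refine div_le_div_of_nonneg_right ?_ (sqrt_nonneg _)
    calc b / erf b * exp (-b ^ 2) * (1 - x) = b / erf b * (exp (-b ^ 2) * (1 - x)) := by ring
      _ ≤ b / erf b * exp (-a ^ 2) := by gcongr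
      _ ≤ _ := by gcongr
  have h2 : 2 - costElasticity a ≤ (1 + x) * (2 - costElasticity b) := by nlinarith
  have h3 : 0 < 2 - costElasticity a := by linarith [costElasticity_lt_half ha0]
  -- Each of the factors `a`, `exp (a²)` and `2 - costElasticity a` exceeds its value at `b` by a
  -- factor of at most `1 + x`.
  unfold inducedRatio marginalCost
  calc √π * a * exp (a ^ 2) * (2 - costElasticity a)
      ≤ √π * ((1 + x) * b) * ((1 + x) * exp (b ^ 2)) * ((1 + x) * (2 - costElasticity b)) := by
        gcongr
    _ = _ := by ring

/-- Funding can optimally focus on cost reductions. -/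
theorem optimalFunding_costReductionEnv :
    OptimalFundingHas costReductionEnv fun ζ h _ => ζ = 0 ∧ 0 < h := by
  refine ⟨exists_isOptimalFunding _, fun ζ h d ρ H => ?_⟩
  obtain ⟨hζ, t, -, hc, hopt⟩ := H.exists_isChoice
  have hK : costReductionEnv.K = 1 / 6 := rfl
  have hq : costReductionEnv.q = 1 := rfl
  have hs : costReductionEnv.s = 100 := rfl
  have hκ : costReductionEnv.κ = 1 := rfl
  have hη : costReductionEnv.η₀ = 7 / 6 := rfl
  have hcost : ∀ z, costReductionEnv.cost z = 1 + z := fun z => by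
    rw [Env.cost, hK, hκ, hη]; ring
  have h0m : (0 : ℝ) ∈ Set.Icc 0 costReductionEnv.K := ⟨le_rfl, costReductionEnv.K_nonneg⟩
  suffices hz : ζ = 0 by
    refine ⟨hz, ?_⟩
    have := H.1.2.2
    rw [hK, hκ, hz] at this
    linarith
  refine le_antisymm (not_lt.1 fun hlt => ?_) hζ.1
  have hζ1 : ζ ≤ 1 / 6 := hK ▸ hζ.2
  obtain ⟨d', t', hc'⟩ := exists_isChoice costReductionEnv h0m.1
  have hd := hc.lt_of_reward_le hζ.1 (by rw [hq]; exact hζ1)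
  have hd' := hc'.lt_of_reward_le le_rfl (by rw [hq]; norm_num)
  have ht := hc.effort_pos hζ.1
  have ht' := hc'.effort_pos le_rfl
  have hE : costReductionEnv.cost 0 / costReductionEnv.s < 1 / costReductionEnv.κ := by
    rw [hcost, hs, hκ]; norm_num
  have htt := hc'.effort_gt hc le_rfl hlt hd' hd hE
  have hA : costReductionEnv.reach ζ = 1 + ζ / 100 := by rw [Env.reach, hs]
  have hA0 : costReductionEnv.reach 0 = 1 := by rw [Env.reach, zero_div, add_zero]
  have hR := hc.inducedRatio_eq hζ.1 hd
  have hR' := hc'.inducedRatio_eq le_rfl hd'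
  rw [hA, hcost] at hR
  rw [hA0, hcost, add_zero, div_one] at hR'
  have ht5 := (costElasticity_lower_of_ratio ht' (by rw [hR']; norm_num)).1
  -- A reward `ζ` raises the reach only by `1 + ζ/100` but the cost parameter by `1 + ζ`. The
  -- resulting fall of the induced ratio is too large for `t'²` to stay within the factor `1 +
  -- ζ/100` of `t²`.
  have hsq : (1 + ζ / 100) * t ^ 2 < t' ^ 2 := by
    by_contra! hle
    have h1 := inducedRatio_le_of_effort_le ht htt ht5 (by positivity) (by linarith) hle
    rw [hR', hR, mul_div_assoc', le_div_iff₀ (by linarith)] at h1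
    have h2 : (1 + ζ / 100) ^ 2 ≤ 1 + ζ / 10 := by nlinarith
    have h3 : (1 + ζ / 100) ^ 3 * (1 + ζ / 100) ≤ (1 + ζ / 10) ^ 2 := by
      have : (1 + ζ / 100) ^ 3 * (1 + ζ / 100) = ((1 + ζ / 100) ^ 2) ^ 2 := by ring
      rw [this]
      exact pow_le_pow_left₀ (sq_nonneg _) h2 2
    nlinarith
  have hcd : t ^ 2 * d < t' ^ 2 * d' := by
    rw [hc.dist_eq hζ.1 hd, hc'.dist_eq le_rfl hd', hA, hA0, hq]
    have hu := noveltyShare_lt ht htt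
    have hu0 := third_lt_noveltyShare ht
    have h4 := mul_lt_mul'' hsq hu (by positivity) (by linarith)
    linarith
  have h1 := hopt 0 h0m _ _ hc'
  -- Without a reward the researcher maximizes the funder's payoff net of `t² d`, the cost parameter
  -- being `1`. As the unrewarded choice has the larger `t² d`, it also has the larger funder's
  -- payoff.
  have h2 := hc'.2.2 d t hc.1 hc.2.1
  rw [profit, profit, successReward, successReward, mul_zero, mul_zero, hcost] at h2
  unfold funderPayoff at h1
  linarith

/-! ### The mixed environment -/

/-- A parameter constellation in which a mix of both instruments is optimal. -/
noncomputable def mixedEnv : Env where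
  q := 1
  s := 6
  K := 3
  κ := 16
  η₀ := 1
  q_pos := by norm_num
  s_ge := by norm_num
  K_nonneg := by norm_num
  η₀_pos := by norm_num
  κ_gt := by norm_num

lemma mixedEnv_q : mixedEnv.q = 1 := rfl

lemma mixedEnv_s : mixedEnv.s = 6 := rfl

lemma mixedEnv_K : mixedEnv.K = 3 := rfl

lemma mixedEnv_κ : mixedEnv.κ = 16 := rfl

lemma mixedEnv_cost (z : ℝ) : mixedEnv.cost z = (13 + z) / 16 := by
  have : mixedEnv.η₀ = 1 := rfl
  rw [Env.cost, mixedEnv_K, mixedEnv_κ, this]; ring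

lemma mixedEnv_reach (z : ℝ) : mixedEnv.reach z = 1 + z / 6 := by
  rw [Env.reach, mixedEnv_s]

lemma mixedEnv_ratio : 1 / mixedEnv.κ < mixedEnv.cost 0 / mixedEnv.s := by
  rw [mixedEnv_cost, mixedEnv_s, mixedEnv_κ]; norm_num

lemma benefitFormula_six : 1.15 ≤ benefitFormula 1 6 ∧ benefitFormula 1 6 ≤ 1.156 := by
  have hr : gapShare 1 6 ^ 2 = 1 / 3 := by
    have := gapShare_sq (q := 1) (d := 6) one_pos (by norm_num)
    linarith
  have hr0 := gapShare_nonneg 1 6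
  have h1 : 0.577 < gapShare 1 6 := by
    by_contra! h; nlinarith
  have h2 : gapShare 1 6 < 0.578 := by
    by_contra! h; nlinarith
  have h3 : 0.365 < lossRoot 1 6 := by
    rw [lossRoot, lt_div_iff₀ (by linarith)]; linarith
  have h4 : lossRoot 1 6 < 0.367 := by
    rw [lossRoot, div_lt_iff₀ (by linarith)]; linarith
  rw [benefitFormula_of_ge one_pos (by norm_num)]
  constructor <;> nlinarith

lemma mixedEnv_cap {z t : ℝ} (hz : 0 ≤ z) (h : IsChoice mixedEnv z mixedEnv.s t) :
    benefitFormula 1 6 + z = (13 + z) / 16 * 6 * marginalCost t := by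
  have := h.successReward_eq hz
  rwa [successReward_of_ge le_rfl, mixedEnv_s, mixedEnv_q, mixedEnv_cost] at this

lemma lt_of_marginalCost_lt {a b : ℝ} (hb : 0 < b) (h : marginalCost a < marginalCost b) :
    a < b := by
  by_contra! hle
  rcases hle.eq_or_lt with rfl | hlt
  · exact lt_irrefl _ h
  · exact lt_asymm h (marginalCost_lt hb hlt)

/-- Output is low at the reward cap. -/
lemma mixedEnv_cap_effort_lt {z t : ℝ} (hz : z ∈ Set.Icc 0 mixedEnv.K)
    (h : IsChoice mixedEnv z mixedEnv.s t) : t < 0.36 := by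
  have h1 := mixedEnv_cap hz.1 h
  have h2 := benefitFormula_six.2
  have hz3 : z ≤ 3 := hz.2
  have hz0 := hz.1
  have he : (1.12 : ℝ) ≤ exp (0.36 ^ 2) := by
    have := add_one_le_exp ((0.36 : ℝ) ^ 2)
    norm_num at this ⊢; linarith
  have h3 := marginalCost_lower (t := 0.36) (by norm_num) he
  refine lt_of_marginalCost_lt (by norm_num) ?_
  by_contra! hle
  nlinarith

lemma erf_mul_outputSurplus_le {a b : ℝ} (ha : 0 < a) (hab : a ≤ b) :
    erf a * outputSurplus a ≤ erf b * outputSurplus b := by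
  rcases hab.eq_or_lt with rfl | hlt
  · exact le_rfl
  · have h1 := outputSurplus_lt ha hlt
    have h2 := strictMono_erf hlt
    exact (mul_lt_mul'' h2 h1 (erf_pos ha).le (outputSurplus_pos ha).le).le

lemma mem_mixedEnv : (2.7 : ℝ) ∈ Set.Icc 0 mixedEnv.K := by
  rw [mixedEnv_K]; norm_num

/-- A large but not maximal reward induces an interior distance. -/
lemma mixedEnv_interior {d t : ℝ} (h : IsChoice mixedEnv 2.7 d t) : d < 4 * mixedEnv.q := by
  have hz := mem_mixedEnv.1
  refine (h.lt_or_eq_cap hz).resolve_right ?_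
  rintro rfl
  have h1 := mixedEnv_cap hz h
  have ht := h.effort_pos hz
  have he : (1.1159 : ℝ) ≤ exp (0.332 ^ 2) := by
    have := exp_lower (x := 0.332 ^ 2) (by norm_num)
    norm_num at this ⊢; linarith
  have he' : exp (0.332 ^ 2) ≤ (1.1167 : ℝ) := by
    have := exp_upper (x := 0.332 ^ 2) (by norm_num) (by norm_num)
    norm_num at this ⊢; linarith
  have h3 := marginalCost_lower (t := 0.332) (by norm_num) he
  have htt : t < 0.332 := by
    refine lt_of_marginalCost_lt (by norm_num) ?_
    by_contra! hle
    linarith [benefitFormula_six.2]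
  have h4 := erf_mul_marginalCost_upper (t := 0.332) (by norm_num) he'
  have h5 := erf_mul_outputSurplus_le ht htt.le
  rw [erf_mul_outputSurplus (by norm_num : (0 : ℝ) < 0.332)] at h5
  have h6 := h.profit_eq hz
  rw [← erf_mul_outputSurplus ht, mixedEnv_cost, mixedEnv_s] at h6
  -- A rational point near the interior optimum at reward `2.7`; its payoff already beats the bound
  -- for the cap.
  have h7 := h.2.2 3.13 0.44 (by norm_num) (by norm_num)
  rw [mixedEnv_s, h6, profit, successReward_of_lt (by rw [mixedEnv_q]; norm_num), mixedEnv_cost,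
    mixedEnv_reach, mixedEnv_q] at h7
  have h8 := erf_lower (t := 0.44) (b := 0.466) (by norm_num) (by norm_num)
  norm_num at h4 h5 h7 h8
  linarith

lemma mixedEnv_effort_bounds {d t : ℝ} (h : IsChoice mixedEnv 2.7 d t) :
    0.4385 < t ∧ t < 0.442 := by
  have hz := mem_mixedEnv.1
  have hd := mixedEnv_interior h
  have ht := h.effort_pos hz
  have hR := h.inducedRatio_eq hz hd
  rw [mixedEnv_reach, mixedEnv_cost] at hR
  constructor
  · refine (inducedRatio_lt_iff (by norm_num) ht).1 ?_
    have he : exp (0.4385 ^ 2) ≤ (1.2122 : ℝ) := by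
      have := exp_upper (x := 0.4385 ^ 2) (by norm_num) (by norm_num)
      norm_num at this ⊢; linarith
    have h1 := marginalCost_upper (t := 0.4385) (by norm_num) he
    have h2 := costElasticity_lower (t := 0.4385) (b := 0.438) (by norm_num) (by norm_num) he
      (by norm_num)
    have h3 := marginalCost_pos (t := 0.4385) (by norm_num)
    have h4 : inducedRatio 0.4385 ≤ marginalCost 0.4385 * (2 - 0.438) :=
      mul_le_mul_of_nonneg_left (by linarith) h3.le
    rw [hR]
    norm_num at h1 h4 ⊢
    linarith
  · refine (inducedRatio_lt_iff ht (by norm_num)).1 ?_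
    have he : (1.2155 : ℝ) ≤ exp (0.442 ^ 2) := by
      have := exp_lower (x := 0.442 ^ 2) (by norm_num)
      norm_num at this ⊢; linarith
    have h1 := marginalCost_lower (t := 0.442) (by norm_num) he
    have h2 := costElasticity_upper (t := 0.442) (b := 0.4386) (by norm_num) (by norm_num) he
      (by norm_num) (by norm_num)
    have h4 : marginalCost 0.442 * (2 - 0.4386) ≤ inducedRatio 0.442 :=
      mul_le_mul_of_nonneg_left (by linarith) (marginalCost_pos (by norm_num)).le
    rw [hR]
    norm_num at h1 h4 ⊢
    linarith

lemma exp_lower_436 : (1.2092 : ℝ) ≤ exp (0.436 ^ 2) := by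
  have := exp_lower (x := 0.436 ^ 2) (by norm_num)
  norm_num at this ⊢; linarith

lemma costElasticity_436 : costElasticity 0.436 ≤ 0.442 :=
  costElasticity_upper (by norm_num) (by norm_num) exp_lower_436 (by norm_num) (by norm_num)

lemma noveltyShare_436 : 0.358 ≤ noveltyShare 0.436 :=
  noveltyShare_lower (by norm_num) (by linarith [costElasticity_436])

lemma mixedEnv_dist_bounds {d t : ℝ} (h : IsChoice mixedEnv 2.7 d t) : 3 < d ∧ d < 3.14 := by
  have hz := mem_mixedEnv.1
  have hd := mixedEnv_interior h
  have ht := h.effort_pos hz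
  obtain ⟨h1, h2⟩ := mixedEnv_effort_bounds h
  have h3 := noveltyShare_le (a := 0.436) (b := t) (by norm_num) (by linarith)
  have h4 := noveltyShare_436
  have he : exp (0.442 ^ 2) ≤ (1.216 : ℝ) := by
    have := exp_upper (x := 0.442 ^ 2) (by norm_num) (by norm_num)
    norm_num at this ⊢; linarith
  have h5 := costElasticity_lower (t := 0.442) (b := 0.4378) (by norm_num) (by norm_num) he
      (by norm_num)
  have h6 : noveltyShare 0.442 ≤ 0.36 := noveltyShare_upper (by norm_num) (by linarith)
  have h7 := noveltyShare_lt ht h2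
  rw [h.dist_eq hz hd, mixedEnv_reach, mixedEnv_q]
  constructor <;> linarith

/-- The maximal reward induces novelty at the cap. -/
lemma mixedEnv_full_reward {d t : ℝ} (h : IsChoice mixedEnv 3 d t) : ¬ d < 4 * mixedEnv.q := by
  intro hd
  have hz : (0 : ℝ) ≤ 3 := by norm_num
  have ht := h.effort_pos hz
  have hR := h.inducedRatio_eq hz hd
  rw [mixedEnv_reach, mixedEnv_cost] at hR
  have he : (1.2198 : ℝ) ≤ exp (0.446 ^ 2) := by
    have := exp_lower (x := 0.446 ^ 2) (by norm_num)
    norm_num at this ⊢; linarith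
  have he' : exp (0.446 ^ 2) ≤ (1.2202 : ℝ) := by
    have := exp_upper (x := 0.446 ^ 2) (by norm_num) (by norm_num)
    norm_num at this ⊢; linarith
  have h1 := marginalCost_lower (t := 0.446) (by norm_num) he
  have h2 := costElasticity_upper (t := 0.446) (b := 0.4375) (by norm_num) (by norm_num) he
    (by norm_num) (by norm_num)
  have h4 : marginalCost 0.446 * (2 - 0.4375) ≤ inducedRatio 0.446 :=
    mul_le_mul_of_nonneg_left (by linarith) (marginalCost_pos (by norm_num)).le
  have htt : t < 0.446 := by
    refine (inducedRatio_lt_iff ht (by norm_num)).1 ?_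
    rw [hR]
    norm_num at h1 h4 ⊢
    linarith
  have h5 := costElasticity_lower (t := 0.446) (b := 0.4365) (by norm_num) (by norm_num) he'
    (by norm_num)
  have h6 : noveltyShare 0.446 ≤ 0.361 := noveltyShare_upper (by norm_num) (by linarith)
  have h7 := noveltyShare_lt ht htt
  have hd' := h.dist_eq hz hd
  rw [mixedEnv_reach, mixedEnv_q] at hd'
  have h8 := erf_mul_outputSurplus_le ht htt.le
  rw [erf_mul_outputSurplus (by norm_num : (0 : ℝ) < 0.446)] at h8
  have h9 := erf_mul_marginalCost_upper (t := 0.446) (by norm_num) he'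
  have h10 := h.profit_eq hz
  rw [← erf_mul_outputSurplus ht, mixedEnv_cost] at h10
  -- A deviation to the cap whose payoff exceeds the upper bound on any interior payoff at the full
  -- reward.
  have h11 := h.2.2 mixedEnv.s 0.346 mixedEnv.s_pos.le (by norm_num)
  rw [h10, profit, successReward_of_ge le_rfl, mixedEnv_cost, mixedEnv_s, mixedEnv_q] at h11
  have h12 := erf_lower (t := 0.346) (b := 0.3752) (by norm_num) (by norm_num)
  have h13 := benefitFormula_six.1
  have h14 : erf t * outputSurplus t ≤ 0.2565 := by norm_num at h8 h9 ⊢; linarith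
  have h15 : d * (erf t * outputSurplus t) ≤ 3.249 * 0.2565 := by
    have := mul_pos (erf_pos ht) (outputSurplus_pos ht)
    exact mul_le_mul (by linarith) h14 this.le (by norm_num)
  have h16 : 0.3752 * 4.15 ≤ erf 0.346 * (benefitFormula 1 6 + 3) :=
    mul_le_mul h12.le (by linarith) (by norm_num) (erf_pos (by norm_num)).le
  norm_num at h11 h15 h16
  linarith

/-- Moderate novelty requires moderate output. -/
lemma mixedEnv_effort_lt_of_dist_le {z d t : ℝ} (hz : 0 ≤ z) (h : IsChoice mixedEnv z d t)
    (hd : d ≤ 3) : t < 0.436 := by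
  by_contra! htt
  have hd4 : d < 4 * mixedEnv.q := by rw [mixedEnv_q]; linarith
  have ht := h.effort_pos hz
  have hR := h.inducedRatio_eq hz hd4
  have hd' := h.dist_eq hz hd4
  rw [mixedEnv_reach, mixedEnv_cost, eq_div_iff (by positivity)] at hR
  rw [mixedEnv_reach, mixedEnv_q] at hd'
  have h1 := marginalCost_lower (t := 0.436) (by norm_num) exp_lower_436
  have h4 : marginalCost 0.436 * (2 - 0.442) ≤ inducedRatio 0.436 :=
    mul_le_mul_of_nonneg_left (by linarith [costElasticity_436])
      (marginalCost_pos (by norm_num)).le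
  have h5 : inducedRatio 0.436 ≤ inducedRatio t := by
    rcases htt.eq_or_lt with e | hlt
    · rw [e]
    · exact (inducedRatio_lt (by norm_num) hlt).le
  have h6 : 1.4555 ≤ inducedRatio t := by norm_num at h1 h4; linarith
  have h7 := noveltyShare_le (a := 0.436) (b := t) (by norm_num) htt
  have h8 := noveltyShare_436
  -- High output requires a high induced ratio, hence a high reward; the novelty formula then gives
  -- at least `8.405 * 0.358 > 3`.
  have h9 : 2.405 ≤ z := by nlinarith
  nlinarith

lemma mixedEnv_output_lt {z z' d d' t t' : ℝ} (hz : 0 ≤ z) (hz' : 0 ≤ z')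
    (h : IsChoice mixedEnv z d t) (h' : IsChoice mixedEnv z' d' t') (hd : d < 4 * mixedEnv.q)
    (hd' : d' < 4 * mixedEnv.q) (hdd : d < d') : t < t' := by
  rcases lt_trichotomy z z' with hlt | rfl | hlt
  · exact h.effort_lt h' hz hlt hd hd' mixedEnv_ratio
  · have := inducedRatio_inj (h.effort_pos hz) (h'.effort_pos hz)
      ((h.inducedRatio_eq hz hd).trans (h'.inducedRatio_eq hz hd').symm)
    rw [h.dist_eq hz hd, h'.dist_eq hz hd', this] at hdd
    exact absurd hdd (lt_irrefl _)
  · have := h'.effort_lt h hz' hlt hd' hd mixedEnv_ratio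
    exact absurd hdd (lt_asymm (h'.dist_lt h hz' hlt hd' hd this.le))

lemma mixedEnv_outputIncreasesBelowCap : OutputIncreasesBelowCap mixedEnv := by
  intro d₁ ρ₁ d₂ ρ₂ h₁ h₂ hd hs
  obtain ⟨z₁, hz₁, t₁, rfl, hc₁⟩ := implementable_iff.1 h₁
  obtain ⟨z₂, hz₂, t₂, rfl, hc₂⟩ := implementable_iff.1 h₂
  exact strictMono_erf (mixedEnv_output_lt hz₁.1 hz₂.1 hc₁ hc₂
    ((hc₁.lt_or_eq_cap hz₁.1).resolve_right (hd.trans hs).ne)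
    ((hc₂.lt_or_eq_cap hz₂.1).resolve_right hs.ne) hd)

/-- Interior choices with high output lie on the frontier. -/
lemma mixedEnv_onFrontier {z d t : ℝ} (hz : z ∈ Set.Icc 0 mixedEnv.K)
    (h : IsChoice mixedEnv z d t) (hd : d < 4 * mixedEnv.q) (ht : 0.36 ≤ t) :
    OnFrontier mixedEnv d (erf t) := by
  obtain ⟨x, hx, hxF⟩ := exists_onFrontier h hz
  rcases hxF.eq_cap_or h hz.1 hd mixedEnv_ratio.ne' with rfl | rfl
  · obtain ⟨z', hz', t', ht', hc'⟩ := implementable_iff.1 hxF.1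
    have := mixedEnv_cap_effort_lt hz' hc'
    rw [strictMono_erf.injective ht'] at this
    linarith
  · exact hxF

/-- Rewards `0` and `2.7` give interior choices ordered the same way in novelty and output. Both
have effort above `0.36`, which the cap never reaches, so they lie on the frontier and refute both
alternatives. -/
lemma mixedEnv_not_outputDecreases : ¬ OutputDecreases mixedEnv := by
  have h0m : (0 : ℝ) ∈ Set.Icc 0 mixedEnv.K := ⟨le_rfl, mixedEnv.K_nonneg⟩
  obtain ⟨d₀, t₀, h₀⟩ := exists_isChoice mixedEnv le_rfl
  obtain ⟨d, t, h⟩ := exists_isChoice mixedEnv mem_mixedEnv.1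
  have hd := mixedEnv_interior h
  have hd₀ := h₀.lt_of_reward_le le_rfl (by rw [mixedEnv_q]; norm_num)
  have hdd : d₀ < d := by
    have h1 := h₀.dist_mem_of_no_reward.2
    rw [mixedEnv_q] at h1
    linarith [(mixedEnv_dist_bounds h).1]
  have htt := mixedEnv_output_lt le_rfl mem_mixedEnv.1 h₀ h hd₀ hd hdd
  have ht₀ : 0.36 < t₀ := by
    refine (inducedRatio_lt_iff (by norm_num) (h₀.effort_pos le_rfl)).1 ?_
    rw [h₀.inducedRatio_eq le_rfl hd₀, mixedEnv_reach, mixedEnv_cost]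
    have he : exp (0.36 ^ 2) ≤ (1.14 : ℝ) := by
      have := exp_upper (x := 0.36 ^ 2) (by norm_num) (by norm_num)
      norm_num at this ⊢; linarith
    have h1 := marginalCost_upper (t := 0.36) (by norm_num) he
    have h2 := costElasticity_lower (t := 0.36) (b := 0.43) (by norm_num) (by norm_num) he
      (by norm_num)
    have h4 : inducedRatio 0.36 ≤ marginalCost 0.36 * (2 - 0.43) :=
      mul_le_mul_of_nonneg_left (by linarith) (marginalCost_pos (by norm_num)).le
    norm_num at h1 h4 ⊢
    linarith
  rintro (H | H)
  · exact lt_asymm hdd (H _ _ _ _ (mixedEnv_onFrontier h0m h₀ hd₀ ht₀.le)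
      (mixedEnv_onFrontier mem_mixedEnv h hd (ht₀.trans htt).le) (strictMono_erf htt))
  · exact lt_asymm (strictMono_erf htt) (H _ _ _ _ (h₀.implementable h0m)
      (h.implementable mem_mixedEnv) hdd)

/-- Funding can optimally combine both instruments and induce moderately excessive novelty. -/
theorem optimalFunding_mixedEnv : OptimalFundingHas mixedEnv fun ζ h d =>
    0 < ζ ∧ 0 < h ∧ 3 * mixedEnv.q < d ∧ d < mixedEnv.s := by
  refine ⟨exists_isOptimalFunding _, fun ζ h d ρ H => ?_⟩
  obtain ⟨hζ, t, -, hc, hopt⟩ := H.exists_isChoice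
  have ht := hc.effort_pos hζ.1
  obtain ⟨d', t', hc'⟩ := exists_isChoice mixedEnv mem_mixedEnv.1
  -- The benchmark is reward `2.7`. It exceeds `0.4 * 1.156`, which bounds the cap, and narrowly
  -- `0.463 * 1.5`, which bounds novelty at most `3`.
  have hF : 0.4645 * 1.4967 < funderPayoff mixedEnv d t := by
    refine lt_of_lt_of_le ?_ (hopt _ mem_mixedEnv _ _ hc')
    obtain ⟨h1, h2⟩ := mixedEnv_dist_bounds hc'
    have h3 := strictMono_erf (mixedEnv_effort_bounds hc').1
    have h4 := erf_lower (t := 0.4385) (b := 0.4645) (by norm_num) (by norm_num)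
    have h5 : 1.4967 < benefitFormula 1 d' := by
      rw [benefitFormula_of_le one_pos (by linarith)]
      nlinarith
    exact mul_lt_mul'' (h4.trans h3) h5 (by norm_num) (by norm_num)
  have hd : d < 4 * mixedEnv.q := by
    refine (hc.lt_or_eq_cap hζ.1).resolve_right ?_
    rintro rfl
    have h1 := strictMono_erf (mixedEnv_cap_effort_lt hζ hc)
    have h2 := erf_upper (t := 0.36) (b := 0.4) (by norm_num) (by norm_num)
    have h3 : funderPayoff mixedEnv mixedEnv.s t ≤ 0.4 * 1.156 :=
      mul_le_mul (h1.trans h2).le benefitFormula_six.2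
        (by linarith [benefitFormula_six.1] : (0 : ℝ) ≤ benefitFormula 1 6) (by norm_num)
    norm_num at h3 hF
    linarith
  have hd3 : 3 * mixedEnv.q < d := by
    by_contra! hle
    rw [mixedEnv_q, mul_one] at hle
    have h1 := strictMono_erf (mixedEnv_effort_lt_of_dist_le hζ.1 hc hle)
    have h2 := erf_upper (t := 0.436) (b := 0.463) (by norm_num) (by norm_num)
    have h3 : funderPayoff mixedEnv d t ≤ 0.463 * 1.5 := by
      have := benefitFormula_le (d := d) (one_pos)
      exact mul_le_mul (h1.trans h2).le (by
        show benefitFormula 1 d ≤ 1.5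
        linarith) (benefitFormula_pos mixedEnv.q_pos (hc.dist_pos hζ.1)).le (by norm_num)
    norm_num at h3 hF
    linarith
  refine ⟨lt_of_le_of_ne hζ.1 ?_, ?_, hd3, hd.trans_le mixedEnv.s_ge⟩
  · rintro rfl
    exact lt_asymm hd3 hc.dist_mem_of_no_reward.2
  · have hne : ζ ≠ 3 := by
      rintro rfl
      exact mixedEnv_full_reward hc hd
    have h1 : ζ < 3 := lt_of_le_of_ne hζ.2 hne
    have h2 := H.1.2.2
    rw [mixedEnv_K, mixedEnv_κ] at h2
    linarith

end ResearchFunding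

theorem mainTheorem9 :
    (∃ E : ResearchFunding.Env,
      ResearchFunding.OptimalFundingHas E fun ζ h _ => 0 < ζ ∧ 0 < h) ∧
    (∃ E : ResearchFunding.Env,
      ResearchFunding.OptimalFundingHas E fun ζ h _ => ζ = 0 ∧ 0 < h) ∧
    (∃ E : ResearchFunding.Env,
      ResearchFunding.OptimalFundingHas E fun ζ h _ => 0 < ζ ∧ h = 0) ∧
    (∀ E : ResearchFunding.Env, ResearchFunding.OutputDecreases E →
      ∀ ζ h d ρ : ℝ, ResearchFunding.IsOptimalFunding E ζ h d ρ → d ≤ 3 * E.q) ∧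
    (∃ E : ResearchFunding.Env, ¬ ResearchFunding.OutputDecreases E ∧
      ResearchFunding.OptimalFundingHas E fun _ _ d => 3 * E.q < d) ∧
    (∃ E : ResearchFunding.Env,
      E.q = 1 ∧ E.s = 6 ∧ E.K = 3 ∧ E.κ = 16 ∧ E.η₀ = 1 ∧
      ¬ ResearchFunding.OutputDecreases E ∧
      ResearchFunding.OutputIncreasesBelowCap E ∧
      ResearchFunding.OptimalFundingHas E fun ζ h d =>
        0 < ζ ∧ 0 < h ∧ 3 * E.q < d ∧ d < E.s) := by
  obtain ⟨hex, hall⟩ := ResearchFunding.optimalFunding_mixedEnv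
  refine ⟨⟨ResearchFunding.mixedEnv, hex, fun ζ h d ρ H => ?_⟩,
    ⟨_, ResearchFunding.optimalFunding_costReductionEnv⟩,
    ⟨_, ResearchFunding.optimalFunding_rewardEnv⟩,
    fun E H ζ h d ρ hopt => H.optimal_dist_le hopt,
    ⟨ResearchFunding.mixedEnv, ResearchFunding.mixedEnv_not_outputDecreases, hex,
      fun ζ h d ρ H => (hall ζ h d ρ H).2.2.1⟩,
    ⟨ResearchFunding.mixedEnv, rfl, rfl, rfl, rfl, rfl,
      ResearchFunding.mixedEnv_not_outputDecreases,
      ResearchFunding.mixedEnv_outputIncreasesBelowCap, hex, hall⟩⟩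
  exact ⟨(hall ζ h d ρ H).1, (hall ζ h d ρ H).2.1⟩
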